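/- Notation. For $M\in\mathbb R^{p\times r}$, the multiplicative compound $M^{(k)}$ is the $\binom pk\times\binom rk$ matrix of all minors of order $k$ of $M$, with rows and columns indexed by the increasing sequences of $k$ indices. For $M\in\mathbb R^{n\times n}$, the additive compound is $M^{[k]}:=\frac{d}{d\varepsilon}(I_n+\varepsilon M)^{(k)}\big|_{\varepsilon=0}$. For a symmetric matrix $S$, $\lambda_1(S)\ge\lambda_2(S)\ge\dots$ are its eigenvalues with multiplicity. For an invertible matrix $H$, $|z|_{2,H}:=|Hz|_2$, and the matrix measure induced by this norm is $\mu_{2,H}(M):=\lim_{\varepsilon\downarrow0}\big(\|I+\varepsilon M\|_{2,H}-1\big)/\varepsilon$, where $\|M\|_{2,H}:=\max_{|z|_{2,H}=1}|Mz|_{2,H}$. A system $\dot x=f(t,x)$, $t\ge0$, $x\in\mathbb R^n$, is called $k$-contractive with rate $\eta>0$ with respect to a norm $|\cdot|$ on $\mathbb R^{\binom nk}$ if for every $t_0\ge0$ and $a\in\mathbb R^n$ there is a solution $x(t;t_0,a)$ on $[t_0,\infty)$ with $x(t_0;t_0,a)=a$, the solutions depend differentiably on $a$, and for all $a^1,\dots,a^{k+1}\in\mathbb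 R^n$, all $r\in\mathbb R^k$ with $r_i\ge0$ and $\sum_i r_i\le1$, and all $t\ge t_0\ge0$, $$|W^{(k)}(t,r)|\le e^{-\eta(t-t_0)}\,|W^{(k)}(t_0,r)|,$$ where $W(t,r)\in\mathbb R^{n\times k}$ has the columns $w^i(t,r)=\frac{\partial}{\partial r_i}\,x\big(t;t_0,\sum_{j=1}^k r_ja^j+(1-\sum_{j=1}^k r_j)a^{k+1}\big)$. Theorem. Let $A\in\mathbb R^{n\times n}$, $B\in\mathbb R^{n\times m}$, $C\in\mathbb R^{q\times n}$, let $\Phi:[0,\infty)\times\mathbb R^q\to\mathbb R^m$ be continuously differentiable, and put $J_\Phi(t,y):=\frac{\partial\Phi}{\partial y}(t,y)$. Consider the Lurie system $$\dot x(t)=Ax(t)-B\,\Phi(t,Cx(t)),$$ and let $J(t,x)=A-BJ_\Phi(t,Cx)C$ be the Jacobian with respect to $x$ of its right-hand side. Fix $k\in\{1,\dots,n\}$. Suppose that there are $\eta_1,\eta_2\in\mathbb R$ and $P=QQ$ with $Q\in\mathbb R^{n\times n}$ symmetric positive definite such that $$P^{(k)}A^{[k]}+(A^{[k]})^TP^{(k)}+\eta_1P^{(k)}+Q^{(k)}\Big((QBB^TQ)^{[k]}+(Q^{-1}C^TCQ^{-1})^{[k]}\Big)Q^{(k)}\preceq0,$$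 and that for all $t\ge0$ and $y\in\mathbb R^q$ at least one of the following two conditions holds: $$\sum_{i=1}^k\lambda_i\Big(Q^{-1}C^T\big(J_\Phi^T(t,y)J_\Phi(t,y)-I_q\big)CQ^{-1}\Big)\le-\eta_2,$$ $$\sum_{i=1}^k\lambda_i\Big(QB\big(J_\Phi(t,y)J_\Phi^T(t,y)-I_m\big)B^TQ\Big)\le-\eta_2.$$ Then $$\mu_{2,Q^{(k)}}\big(J^{[k]}(t,x)\big)\le-\frac{\eta_1+\eta_2}2\qquad\text{for all }t\ge0,\ x\in\mathbb R^n.$$ In particular, if $\eta_1+\eta_2>0$, then the Lurie system is $k$-contractive with rate $(\eta_1+\eta_2)/2$ with respect to the scaled $L_2$ norm $|z|_{2,Q^{(k)}}=|Q^{(k)}z|_2$. -/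

import Mathlib

open Matrix Filter Topology

noncomputable section

namespace Lurie

/-- The `k`-multiplicative compound `A^{(k)}`: the matrix of all minors of order `k`.  Its rows and
columns are indexed by the increasing sequences of `k` indices. -/
def mulCompound {n m : ℕ} (k : ℕ) (A : Matrix (Fin n) (Fin m) ℝ) :
    Matrix (Fin k ↪o Fin n) (Fin k ↪o Fin m) ℝ :=
  Matrix.of fun α β => (A.submatrix α β).det

/-- The `k`-additive compound `A^{[k]} = d/dε (I + ε A)^{(k)}` at `ε = 0`, taken entrywise. -/
def addCompound {n : ℕ} (k : ℕ) (A : Matrix (Fin n) (Fin n) ℝ) :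
    Matrix (Fin k ↪o Fin n) (Fin k ↪o Fin n) ℝ :=
  Matrix.of fun α β => deriv (fun ε : ℝ => mulCompound k (1 + ε • A) α β) 0

/-- For an `n × k` matrix `W` the compound `W^{(k)}` has a single column; this is that column,
i.e. the coordinate vector of the wedge product of the columns of `W`. -/
def wedge {n k : ℕ} (W : Matrix (Fin n) (Fin k) ℝ) : (Fin k ↪o Fin n) → ℝ :=
  fun α => mulCompound k W α (RelEmbedding.refl (· ≤ ·))

/-- The sum of the `k` largest eigenvalues (with multiplicity) of a symmetric matrix;
`eigenvalues₀` lists the eigenvalues in decreasing order. -/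
def sumLargestEigenvalues {n : ℕ} (k : ℕ) (S : Matrix (Fin n) (Fin n) ℝ)
    (hS : S.IsHermitian) : ℝ :=
  ∑ i : Fin (Fintype.card (Fin n)) with i.val < k, hS.eigenvalues₀ i

/-- The scaled `L₂` norm `|z|_{2,H} = |H z|₂`. -/
def scaledNorm {ι : Type*} [Fintype ι] (H : Matrix ι ι ℝ) (z : ι → ℝ) : ℝ :=
  ‖WithLp.toLp 2 (H *ᵥ z)‖

/-- The matrix norm `‖A‖ = max_{|x| = 1} |A x|` induced by a vector norm `N`. -/
def inducedNorm {ι : Type*} [Fintype ι] (N : (ι → ℝ) → ℝ) (A : Matrix ι ι ℝ) : ℝ :=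
  sSup ((fun x => N (A *ᵥ x)) '' {x | N x = 1})

/-- `μ` is the matrix measure (logarithmic norm) of `A` induced by the vector norm `N`:
`μ = lim_{ε ↓ 0} (‖I + ε A‖ - 1) / ε`. -/
def IsMatrixMeasure {ι : Type*} [Fintype ι] [DecidableEq ι] (N : (ι → ℝ) → ℝ) (A : Matrix ι ι ℝ)
    (μ : ℝ) : Prop :=
  Tendsto (fun ε : ℝ => (inducedNorm N (1 + ε • A) - 1) / ε) (𝓝[>] 0) (𝓝 μ)

/-- The Jacobian matrix of `g : ℝ^p → ℝ^n` at `y`. -/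
def jacobian {p n : ℕ} (g : (Fin p → ℝ) → (Fin n → ℝ)) (y : Fin p → ℝ) :
    Matrix (Fin n) (Fin p) ℝ :=
  LinearMap.toMatrix' (fderiv ℝ g y : (Fin p → ℝ) →ₗ[ℝ] (Fin n → ℝ))

/-- The right-hand side `A x - B Φ(t, C x)` of the Lurie system. -/
def vectorField {n m q : ℕ} (A : Matrix (Fin n) (Fin n) ℝ) (B : Matrix (Fin n) (Fin m) ℝ)
    (C : Matrix (Fin q) (Fin n) ℝ) (Φ : ℝ → (Fin q → ℝ) → (Fin m → ℝ)) (t : ℝ) (x : Fin n → ℝ) :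
    Fin n → ℝ :=
  A *ᵥ x - B *ᵥ Φ t (C *ᵥ x)

/-- `X t a` is a solution of `ẋ = f(t, x)` on `[t₀, ∞)` with value `a` at time `t₀`, for
every `a`. -/
def IsFlowFrom {n : ℕ} (f : ℝ → (Fin n → ℝ) → (Fin n → ℝ)) (t₀ : ℝ)
    (X : ℝ → (Fin n → ℝ) → (Fin n → ℝ)) : Prop :=
  ∀ a, X t₀ a = a ∧ IsIntegralCurveOn (fun t => X t a) f (Set.Ici t₀)

/-- The affine parametrization `r ↦ ∑ i, rᵢ aᵢ + (1 - ∑ i, rᵢ) a_{k+1}` of the simplex with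
vertices `a₁, …, a_{k+1}`. -/
def simplexMap {n k : ℕ} (a : Fin (k + 1) → Fin n → ℝ) (r : Fin k → ℝ) : Fin n → ℝ :=
  ∑ i, r i • a i.castSucc + (1 - ∑ i, r i) • a (Fin.last k)

/-- The system `ẋ = f(t, x)`, `t ≥ 0`, on `ℝ^n` is `k`-contractive with rate `η` with respect to
the norm `N`.  Solutions exist for all forward times and depend differentiably on the initial
value, and for every simplex of initial values at a time `t₀ ≥ 0`, parametrized by `r`, the wedge
product of the vectors `wⁱ(t, r) = ∂x(t)/∂rᵢ` (the columns of the Jacobian matrix in `r`) decays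
exponentially with rate `η` in the norm `N`. -/
structure IsKContractive {n : ℕ} (f : ℝ → (Fin n → ℝ) → (Fin n → ℝ)) (k : ℕ)
    (N : ((Fin k ↪o Fin n) → ℝ) → ℝ) (η : ℝ) : Prop where
  rate_pos : 0 < η
  exists_flow : ∀ t₀ : ℝ, 0 ≤ t₀ → ∃ X, IsFlowFrom f t₀ X
  differentiable : ∀ t₀ : ℝ, 0 ≤ t₀ → ∀ X, IsFlowFrom f t₀ X →
    ∀ t, t₀ ≤ t → Differentiable ℝ (X t)
  decay : ∀ t₀ : ℝ, 0 ≤ t₀ → ∀ X, IsFlowFrom f t₀ X →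
    ∀ (a : Fin (k + 1) → Fin n → ℝ) (r : Fin k → ℝ), (∀ i, 0 ≤ r i) → ∑ i, r i ≤ 1 →
    ∀ t, t₀ ≤ t →
      N (wedge (jacobian (fun s => X t (simplexMap a s)) r)) ≤
        Real.exp (-η * (t - t₀)) * N (wedge (jacobian (fun s => X t₀ (simplexMap a s)) r))

/-- The matrix `Q⁻¹ Cᵀ (Jᵀ J - I) C Q⁻¹` is symmetric. -/
theorem isHermitian_gainC {n m q : ℕ} {Q : Matrix (Fin n) (Fin n) ℝ} (hQ : Q.IsHermitian)
    (C : Matrix (Fin q) (Fin n) ℝ) (J : Matrix (Fin m) (Fin q) ℝ) :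
    (Q⁻¹ * Cᵀ * (Jᵀ * J - 1) * C * Q⁻¹).IsHermitian := by
  have hQ' : Qᵀ = Q := by simpa [Matrix.IsHermitian] using hQ
  simp [Matrix.IsHermitian, Matrix.transpose_nonsing_inv, hQ', Matrix.mul_assoc]

/-- The matrix `Q B (J Jᵀ - I) Bᵀ Q` is symmetric. -/
theorem isHermitian_gainB {n m q : ℕ} {Q : Matrix (Fin n) (Fin n) ℝ} (hQ : Q.IsHermitian)
    (B : Matrix (Fin n) (Fin m) ℝ) (J : Matrix (Fin m) (Fin q) ℝ) :
    (Q * B * (J * Jᵀ - 1) * Bᵀ * Q).IsHermitian := by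
  have hQ' : Qᵀ = Q := by simpa [Matrix.IsHermitian] using hQ
  simp [Matrix.IsHermitian, hQ', Matrix.mul_assoc]

end Lurie

end

open Matrix Filter Topology

noncomputable section

namespace Lurie

/-! ### Compound matrices -/

/-! Put H = Q^(k) and T = H J^[k] H⁻¹ = (Q J Q⁻¹)^[k]. In the coordinates H z the scaled norm is
Euclidean, so everything reduces to T + Tᵀ ⪯ -(η₁ + η₂) I. Conjugating the hypothesis on A by H⁻¹
leaves the feedback term Q B J_Φ C Q⁻¹ = X Y, and completing the square gives -XY - (XY)ᵀ = XXᵀ +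
YᵀY - (X + Yᵀ)(X + Yᵀ)ᵀ. Depending on which factor absorbs J_Φ, XXᵀ + YᵀY equals QBBᵀQ + Q⁻¹CᵀCQ⁻¹
plus exactly the matrix G of one of the two gain conditions. The additive compound is linear, and on
symmetric matrices its eigenvalues are the sums of k eigenvalues at distinct indices; hence the
compound of the square is positive semidefinite and G^[k] ⪯ -η₂ I. This is
`posSemidef_compound_bound`.

The matrix measure is the right derivative at 0 of the convex function ε ↦ ‖I + εT‖, and the
quadratic form of T bounds it.

For contraction, the derivative of the flow in the initial value solves the variational equation.
Since compounds are multiplicative (Cauchy–Binet), the wedge z of the columns solves ż = J^[k] z,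
and e^{2ηt}|Hz|² is nonincreasing for η = (η₁ + η₂)/2. Forward completeness comes from the gain
conditions too: a bound on the k largest eigenvalues bounds the trace, hence J_Φ C Q⁻¹ or Q B J_Φ,
hence B J_Φ C, so the vector field is globally Lipschitz uniformly in time (`exists_bound_of_gain`).
-/

theorem exists_orderEmb_comp_perm {k m : ℕ} (f : Fin k → Fin m) (hf : Function.Injective f) :
    ∃ (γ : Fin k ↪o Fin m) (σ : Equiv.Perm (Fin k)), f = γ ∘ σ := by
  have hcard : (Finset.univ.image f).card = k := by
    rw [Finset.card_image_of_injective _ hf, Finset.card_univ, Fintype.card_fin]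
  set γ := (Finset.univ.image f).orderEmbOfFin hcard
  have hmem : ∀ i, ∃ j, γ j = f i := fun i => by
    have : f i ∈ Set.range γ := by
      rw [Finset.range_orderEmbOfFin]
      simp
    exact this
  choose s hs using hmem
  have hinj : Function.Injective s := fun i j h => hf (by rw [← hs, ← hs, h])
  refine ⟨γ, Equiv.ofBijective s (Finite.injective_iff_bijective.mp hinj), ?_⟩
  ext i
  simp [hs]

theorem eq_of_range_subset {k m : ℕ} {γ δ : Fin k ↪o Fin m} (h : ∀ i, ∃ j, γ j = δ i) :
    γ = δ := by
  have hcard : (Finset.univ.image γ).card = k := by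
    rw [Finset.card_image_of_injective _ γ.injective, Finset.card_univ, Fintype.card_fin]
  have h1 := Finset.orderEmbOfFin_unique hcard (f := γ) (by simp) γ.strictMono
  have h2 := Finset.orderEmbOfFin_unique hcard (f := δ) (by simpa using h) δ.strictMono
  exact DFunLike.coe_injective (h1.trans h2.symm)

/-- The **Cauchy–Binet formula**. -/
theorem det_mul_eq_sum_orderEmb {k m : ℕ} (M : Matrix (Fin k) (Fin m) ℝ)
    (N : Matrix (Fin m) (Fin k) ℝ) :
    (M * N).det = ∑ γ : Fin k ↪o Fin m, (M.submatrix id γ).det * (N.submatrix γ id).det := by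
  -- Both sides are alternating forms in the columns of N, so it suffices to compare them on tuples
  -- of distinct basis vectors, where only one γ contributes.
  let L : (Fin m → ℝ) [⋀^Fin k]→ₗ[ℝ] ℝ :=
    (detRowAlternating (n := Fin k) (R := ℝ)).compLinearMap (Matrix.vecMulLinear Mᵀ)
  let R : (Fin m → ℝ) [⋀^Fin k]→ₗ[ℝ] ℝ :=
    ∑ γ : Fin k ↪o Fin m, (M.submatrix id γ).det •
      (detRowAlternating (n := Fin k) (R := ℝ)).compLinearMap (LinearMap.funLeft ℝ ℝ γ)
  have hL : ∀ v, L v = (Matrix.of v * Mᵀ).det := fun v => rfl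
  have hR : ∀ v, R v = ∑ γ : Fin k ↪o Fin m, (M.submatrix id γ).det *
      ((Matrix.of v).submatrix id γ).det := fun v => by
    let ev : ((Fin m → ℝ) [⋀^Fin k]→ₗ[ℝ] ℝ) →+ ℝ :=
      { toFun := fun f => f v, map_zero' := rfl, map_add' := fun _ _ => rfl }
    exact map_sum ev _ _
  have hLR : L = R := by
    refine Module.Basis.ext_alternating (Pi.basisFun ℝ (Fin m)) fun f hf => ?_
    obtain ⟨γ, σ, rfl⟩ := exists_orderEmb_comp_perm f hf
    rw [hL, hR, Finset.sum_eq_single γ]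
    · have h1 : ((Matrix.of fun i => Pi.basisFun ℝ (Fin m) ((γ ∘ σ) i)) * Mᵀ)
          = ((M.submatrix id γ)ᵀ).submatrix σ id := by
        ext i j
        simp [Matrix.mul_apply, Pi.single_apply]
      have h2 : (Matrix.of fun i => Pi.basisFun ℝ (Fin m) ((γ ∘ σ) i)).submatrix id γ
          = (1 : Matrix (Fin k) (Fin k) ℝ).submatrix σ id := by
        ext i j
        simp [Pi.single_apply, Matrix.one_apply, eq_comm]
      rw [h1, h2, det_permute, det_permute, det_transpose, det_one, mul_one, mul_comm]
    · intro δ _ hδ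
      have : ∃ j, ∀ i, γ i ≠ δ j := by
        by_contra! h
        exact hδ (eq_of_range_subset h).symm
      obtain ⟨j, hj⟩ := this
      refine mul_eq_zero_of_right _ (Matrix.det_eq_zero_of_column_eq_zero j fun i => ?_)
      simp [(hj (σ i)).symm]
    · simp
  have := (hL Nᵀ).symm.trans ((DFunLike.congr_fun hLR _).trans (hR Nᵀ))
  have h3 : (Matrix.of Nᵀ * Mᵀ) = (M * N)ᵀ := by rw [Matrix.transpose_mul]; rfl
  rw [h3, det_transpose] at this
  rw [this]
  refine Finset.sum_congr rfl fun γ _ => ?_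
  rw [← det_transpose (N.submatrix γ id)]
  rfl

theorem mulCompound_mul {n m p : ℕ} (k : ℕ) (A : Matrix (Fin n) (Fin m) ℝ)
    (B : Matrix (Fin m) (Fin p) ℝ) :
    mulCompound k (A * B) = mulCompound k A * mulCompound k B := by
  ext α β
  simp only [mulCompound, Matrix.mul_apply, Matrix.of_apply]
  rw [Matrix.submatrix_mul A B α id β Function.bijective_id, det_mul_eq_sum_orderEmb]
  rfl

theorem mulCompound_transpose {n m : ℕ} (k : ℕ) (A : Matrix (Fin n) (Fin m) ℝ) :
    mulCompound k Aᵀ = (mulCompound k A)ᵀ := by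
  ext α β
  simp only [mulCompound, Matrix.of_apply, Matrix.transpose_apply]
  rw [← det_transpose]
  rfl

theorem mulCompound_diagonal {n : ℕ} (k : ℕ) (d : Fin n → ℝ) :
    mulCompound k (diagonal d) = diagonal fun α => ∏ i, d (α i) := by
  ext α β
  simp only [mulCompound, Matrix.of_apply]
  by_cases h : α = β
  · subst h
    rw [Matrix.submatrix_diagonal _ _ α.injective, det_diagonal, diagonal_apply_eq]
    rfl
  · rw [diagonal_apply_ne _ h]
    have : ∃ j, ∀ i, α i ≠ β j := by
      by_contra! h'
      exact h (eq_of_range_subset h')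
    obtain ⟨j, hj⟩ := this
    refine Matrix.det_eq_zero_of_column_eq_zero j fun i => ?_
    simp [diagonal_apply_ne _ (hj i)]

theorem mulCompound_one {n : ℕ} (k : ℕ) :
    mulCompound k (1 : Matrix (Fin n) (Fin n) ℝ) = 1 := by
  rw [← diagonal_one, mulCompound_diagonal]
  simp

/-- The directional derivative of the multiplicative compound at `W` in the direction `V`. -/
def mulCompoundDeriv {n m : ℕ} (k : ℕ) (W V : Matrix (Fin n) (Fin m) ℝ) :
    Matrix (Fin k ↪o Fin n) (Fin k ↪o Fin m) ℝ :=
  Matrix.of fun α β => ∑ σ : Equiv.Perm (Fin k), (Equiv.Perm.sign σ : ℝ) *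
    ∑ i, (∏ j ∈ Finset.univ.erase i, W (α (σ j)) (β j)) * V (α (σ i)) (β i)

/-- Product rule in the Leibniz expansion. One-sided derivatives are allowed because solutions live
on half-lines. -/
theorem hasDerivWithinAt_mulCompound {n m : ℕ} (k : ℕ) {W : ℝ → Matrix (Fin n) (Fin m) ℝ}
    {V : Matrix (Fin n) (Fin m) ℝ} {s : Set ℝ} {t : ℝ}
    (h : ∀ i j, HasDerivWithinAt (fun u => W u i j) (V i j) s t)
    (α : Fin k ↪o Fin n) (β : Fin k ↪o Fin m) :
    HasDerivWithinAt (fun u => mulCompound k (W u) α β) (mulCompoundDeriv k (W t) V α β) s t := by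
  simp only [mulCompound, mulCompoundDeriv, Matrix.of_apply, det_apply']
  refine HasDerivWithinAt.fun_sum fun σ _ => HasDerivWithinAt.const_mul _ ?_
  simpa using HasDerivWithinAt.fun_finsetProd (u := Finset.univ)
    (fun i _ => h (α (σ i)) (β i))

theorem mulCompoundDeriv_add {n m : ℕ} (k : ℕ) (W V V' : Matrix (Fin n) (Fin m) ℝ) :
    mulCompoundDeriv k W (V + V') = mulCompoundDeriv k W V + mulCompoundDeriv k W V' := by
  ext α β
  simp only [mulCompoundDeriv, Matrix.of_apply, Matrix.add_apply, mul_add, Finset.sum_add_distrib]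

theorem mulCompoundDeriv_smul {n m : ℕ} (k : ℕ) (c : ℝ) (W V : Matrix (Fin n) (Fin m) ℝ) :
    mulCompoundDeriv k W (c • V) = c • mulCompoundDeriv k W V := by
  ext α β
  simp only [mulCompoundDeriv, Matrix.of_apply, Matrix.smul_apply, smul_eq_mul, Finset.mul_sum]
  refine Finset.sum_congr rfl fun σ _ => Finset.sum_congr rfl fun i _ => ?_
  ring

theorem hasDerivAt_mulCompound_line {n m : ℕ} (k : ℕ) (W V : Matrix (Fin n) (Fin m) ℝ)
    (α : Fin k ↪o Fin n) (β : Fin k ↪o Fin m) :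
    HasDerivAt (fun ε : ℝ => mulCompound k (W + ε • V) α β) (mulCompoundDeriv k W V α β) 0 := by
  have := hasDerivWithinAt_mulCompound k (W := fun ε : ℝ => W + ε • V) (V := V) (s := Set.univ)
    (t := 0) (fun i j => by
      simpa using ((hasDerivAt_id (0 : ℝ)).mul_const (V i j)).const_add (W i j)) α β
  simpa using this

/-- The `deriv` in the definition is a genuine derivative with a closed form, from which linearity
can be read off. -/
theorem addCompound_eq {n : ℕ} (k : ℕ) (A : Matrix (Fin n) (Fin n) ℝ) :
    addCompound k A = mulCompoundDeriv k 1 A := by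
  ext α β
  exact (hasDerivAt_mulCompound_line k 1 A α β).deriv

theorem hasDerivAt_addCompound {n : ℕ} (k : ℕ) (A : Matrix (Fin n) (Fin n) ℝ)
    (α β : Fin k ↪o Fin n) :
    HasDerivAt (fun ε : ℝ => mulCompound k (1 + ε • A) α β) (addCompound k A α β) 0 := by
  rw [addCompound_eq]
  exact hasDerivAt_mulCompound_line k 1 A α β

theorem addCompound_add {n : ℕ} (k : ℕ) (A B : Matrix (Fin n) (Fin n) ℝ) :
    addCompound k (A + B) = addCompound k A + addCompound k B := by
  simp only [addCompound_eq, mulCompoundDeriv_add]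

theorem addCompound_neg {n : ℕ} (k : ℕ) (A : Matrix (Fin n) (Fin n) ℝ) :
    addCompound k (-A) = -addCompound k A := by
  rw [addCompound_eq, addCompound_eq, ← neg_one_smul ℝ A, mulCompoundDeriv_smul, neg_one_smul]

theorem addCompound_sub {n : ℕ} (k : ℕ) (A B : Matrix (Fin n) (Fin n) ℝ) :
    addCompound k (A - B) = addCompound k A - addCompound k B := by
  rw [sub_eq_add_neg, addCompound_add, addCompound_neg, sub_eq_add_neg]

theorem addCompound_transpose {n : ℕ} (k : ℕ) (A : Matrix (Fin n) (Fin n) ℝ) :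
    addCompound k Aᵀ = (addCompound k A)ᵀ := by
  ext α β
  refine (hasDerivAt_addCompound k Aᵀ α β).unique ?_
  rw [Matrix.transpose_apply]
  convert! hasDerivAt_addCompound k A β α using 1
  funext ε
  rw [← Matrix.transpose_apply (mulCompound k (1 + ε • A)), ← mulCompound_transpose]
  simp

theorem hasDerivAt_mul_mul {ι₁ ι₂ ι₃ ι₄ : Type*} [Fintype ι₂] [Fintype ι₃]
    (L : Matrix ι₁ ι₂ ℝ) (R : Matrix ι₃ ι₄ ℝ) {M : ℝ → Matrix ι₂ ι₃ ℝ} {M' : Matrix ι₂ ι₃ ℝ}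
    {t : ℝ} (h : ∀ i j, HasDerivAt (fun u => M u i j) (M' i j) t) (i : ι₁) (j : ι₄) :
    HasDerivAt (fun u => (L * M u * R) i j) ((L * M' * R) i j) t := by
  simp only [Matrix.mul_apply]
  exact HasDerivAt.fun_sum fun b _ =>
    (HasDerivAt.fun_sum fun a _ => (h a b).const_mul (L i a)).mul_const (R b j)

/-- T (I + εA) T' = I + ε T A T'; apply multiplicativity of the compound and differentiate at ε = 0.
-/
theorem addCompound_conj {n : ℕ} (k : ℕ) (A T T' : Matrix (Fin n) (Fin n) ℝ) (hT : T * T' = 1) :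
    addCompound k (T * A * T') = mulCompound k T * addCompound k A * mulCompound k T' := by
  ext α β
  refine (hasDerivAt_addCompound k _ α β).unique ?_
  convert! hasDerivAt_mul_mul (mulCompound k T) (mulCompound k T') (hasDerivAt_addCompound k A) α β
    using 2 with ε
  rw [← mulCompound_mul, ← mulCompound_mul, mul_add, add_mul, mul_one, hT]
  simp

/-- The compound of a solution `W` of a linear equation `Ẇ = J W` solves the compound equation. -/
theorem mulCompoundDeriv_mul {n m : ℕ} (k : ℕ) (J : Matrix (Fin n) (Fin n) ℝ)
    (W : Matrix (Fin n) (Fin m) ℝ) :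
    mulCompoundDeriv k W (J * W) = addCompound k J * mulCompound k W := by
  ext α β
  refine (hasDerivAt_mulCompound_line k W (J * W) α β).unique ?_
  have := hasDerivAt_mul_mul (1 : Matrix _ _ ℝ) (mulCompound k W) (hasDerivAt_addCompound k J) α β
  rw [Matrix.one_mul] at this
  -- W + ε J W = (I + ε J) W, so the compound factors before differentiation.
  convert! this using 2 with ε
  rw [Matrix.one_mul, ← mulCompound_mul, Matrix.add_mul]
  simp

theorem addCompound_diagonal {n : ℕ} (k : ℕ) (d : Fin n → ℝ) :
    addCompound k (diagonal d) = diagonal fun α => ∑ i, d (α i) := by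
  have key : ∀ ε : ℝ, mulCompound k (1 + ε • diagonal d)
      = diagonal fun α : Fin k ↪o Fin n => ∏ i, (1 + ε * d (α i)) := fun ε => by
    rw [← mulCompound_diagonal k fun i => 1 + ε * d i, ← diagonal_one, ← diagonal_smul,
      diagonal_add]
    rfl
  ext α β
  refine (hasDerivAt_addCompound k _ α β).unique ?_
  simp only [key]
  by_cases h : α = β
  · subst h
    simp only [diagonal_apply_eq]
    have := HasDerivAt.fun_finsetProd (u := Finset.univ) (x := (0 : ℝ))
      (f := fun i ε => 1 + ε * d (α i)) (f' := fun i => d (α i))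
      (fun i _ => by simpa using ((hasDerivAt_id (0 : ℝ)).mul_const (d (α i))).const_add 1)
    simpa using this
  · simp only [diagonal_apply_ne _ h]
    exact hasDerivAt_const _ _

theorem mulCompound_mul_eq_one {n : ℕ} (k : ℕ) {U U' : Matrix (Fin n) (Fin n) ℝ}
    (h : U * U' = 1) : mulCompound k U * mulCompound k U' = 1 := by
  rw [← mulCompound_mul, h, mulCompound_one]

/-! ### Additive compounds of symmetric matrices -/

theorem val_le_orderEmb {k N : ℕ} (γ : Fin k ↪o Fin N) (i : Fin k) : i.val ≤ (γ i).val := by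
  obtain ⟨i, hi⟩ := i
  induction i with
  | zero => exact Nat.zero_le _
  | succ j ih =>
    have h : γ ⟨j, by omega⟩ < γ ⟨j + 1, hi⟩ := γ.strictMono (by simp)
    have := ih (by omega)
    rw [Fin.lt_def] at h
    simp only at this ⊢
    omega

theorem sum_filter_val_lt {k N : ℕ} (hkN : k ≤ N) (g : Fin N → ℝ) :
    ∑ i : Fin N with i.val < k, g i = ∑ i : Fin k, g (Fin.castLE hkN i) := by
  symm
  refine Finset.sum_bij (fun i _ => Fin.castLE hkN i) ?_ ?_ ?_ ?_
  · intro i _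
    simp
  · intro i _ j _ h
    simpa using h
  · intro b hb
    simp only [Finset.mem_filter, Finset.mem_univ, true_and] at hb
    exact ⟨⟨b.val, hb⟩, Finset.mem_univ _, by ext; simp⟩
  · intro i _
    rfl

/-- After sorting, the i-th selected index is at least i, so an antitone `g` can be compared term by
term. -/
theorem sum_comp_le_sum_filter {k N : ℕ} {g : Fin N → ℝ} (hg : Antitone g) {f : Fin k → Fin N}
    (hf : Function.Injective f) : ∑ i, g (f i) ≤ ∑ i : Fin N with i.val < k, g i := by
  have hkN : k ≤ N := by simpa using Fintype.card_le_of_injective f hf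
  obtain ⟨γ, σ, rfl⟩ := exists_orderEmb_comp_perm f hf
  rw [sum_filter_val_lt hkN]
  have : ∑ i, g ((γ ∘ σ) i) = ∑ i, g (γ i) := Equiv.sum_comp σ fun i => g (γ i)
  rw [this]
  refine Finset.sum_le_sum fun i _ => hg ?_
  rw [Fin.le_def]
  exact val_le_orderEmb γ i

theorem exists_orthogonal_diagonalization {n : ℕ} {S : Matrix (Fin n) (Fin n) ℝ}
    (hS : S.IsHermitian) : ∃ U : Matrix (Fin n) (Fin n) ℝ, U * Uᵀ = 1 ∧
      S = U * diagonal hS.eigenvalues * Uᵀ := by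
  refine ⟨hS.eigenvectorUnitary, ?_, ?_⟩
  · have := Matrix.mem_unitaryGroup_iff.mp hS.eigenvectorUnitary.2
    rwa [Matrix.star_eq_conjTranspose, conjTranspose_eq_transpose_of_trivial] at this
  · have := hS.spectral_theorem
    rw [Unitary.conjStarAlgAut_apply, Matrix.star_eq_conjTranspose,
      conjTranspose_eq_transpose_of_trivial] at this
    exact this

theorem posSemidef_conj {ι : Type*} [Fintype ι] {M : Matrix ι ι ℝ} (hM : M.PosSemidef)
    (L : Matrix ι ι ℝ) : (L * M * Lᵀ).PosSemidef := by
  have := hM.mul_mul_conjTranspose_same L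
  rwa [conjTranspose_eq_transpose_of_trivial] at this

/-- An orthogonal diagonalization of S induces one of S^[k], whose diagonal entries are sums of k
eigenvalues of S. -/
theorem posSemidef_addCompound {n : ℕ} (k : ℕ) {S : Matrix (Fin n) (Fin n) ℝ}
    (hS : S.PosSemidef) : (addCompound k S).PosSemidef := by
  obtain ⟨U, hU, hSU⟩ := exists_orthogonal_diagonalization hS.isHermitian
  rw [hSU, addCompound_conj k _ _ _ hU, addCompound_diagonal, mulCompound_transpose]
  exact posSemidef_conj (PosSemidef.diagonal fun α =>
    Finset.sum_nonneg fun i _ => hS.eigenvalues_nonneg _) _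

/-- The additive compound of a symmetric matrix is bounded by the sum of the largest
eigenvalues. -/
theorem posSemidef_smul_one_sub_addCompound {n : ℕ} (k : ℕ) {S : Matrix (Fin n) (Fin n) ℝ}
    (hS : S.IsHermitian) :
    (sumLargestEigenvalues k S hS • 1 - addCompound k S).PosSemidef := by
  obtain ⟨U, hU, hSU⟩ := exists_orthogonal_diagonalization hS
  have h1 : mulCompound k U * (mulCompound k U)ᵀ = 1 := by
    rw [← mulCompound_transpose]
    exact mulCompound_mul_eq_one k hU
  have h2 : addCompound k S = mulCompound k U *
      diagonal (fun α : Fin k ↪o Fin n => ∑ i, hS.eigenvalues (α i)) * (mulCompound k U)ᵀ := by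
    conv_lhs => rw [hSU]
    rw [addCompound_conj k _ _ _ hU, addCompound_diagonal, mulCompound_transpose]
  have h3 : sumLargestEigenvalues k S hS • 1 - addCompound k S = mulCompound k U *
      diagonal (fun α : Fin k ↪o Fin n =>
        sumLargestEigenvalues k S hS - ∑ i, hS.eigenvalues (α i)) * (mulCompound k U)ᵀ := by
    rw [← diagonal_sub, mul_sub, sub_mul, ← h2, ← h1]
    simp [← Matrix.smul_one_eq_diagonal]
  rw [h3]
  refine posSemidef_conj (PosSemidef.diagonal fun α => sub_nonneg.mpr ?_) _
  -- `eigenvalues` is `eigenvalues₀` reindexed through this equivalence; `f` translates α to the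
  -- sorted list.
  exact sum_comp_le_sum_filter (f := fun i => (Fintype.equivOfCardEq (Fintype.card_fin _)).symm (α i))
    hS.eigenvalues₀_antitone ((Equiv.injective _).comp α.injective)

/-- The mean of all eigenvalues is at most the mean of the `k` largest ones. -/
theorem mul_trace_le_mul_sumLargestEigenvalues {n k : ℕ} (hkn : k ≤ n)
    {S : Matrix (Fin n) (Fin n) ℝ} (hS : S.IsHermitian) :
    k * S.trace ≤ n * sumLargestEigenvalues k S hS := by
  have htr : S.trace = ∑ i, hS.eigenvalues₀ i := by
    rw [hS.trace_eq_sum_eigenvalues]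
    exact Equiv.sum_comp (Fintype.equivOfCardEq (Fintype.card_fin _)).symm hS.eigenvalues₀
  have hcard : k ≤ Fintype.card (Fin n) := by simpa using hkn
  set g := hS.eigenvalues₀ with hg
  set s := sumLargestEigenvalues k S hS with hs
  have hs' : s = ∑ i : Fin k, g (Fin.castLE hcard i) := sum_filter_val_lt hcard g
  -- An eigenvalue beyond the first k is at most each of them, so k copies of it are at most their
  -- sum.
  have hle : ∀ i : Fin (Fintype.card (Fin n)), ¬ i.val < k → k * g i ≤ s := fun i hi => by
    rw [hs']
    calc (k : ℝ) * g i = ∑ _j : Fin k, g i := by simp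
      _ ≤ _ := Finset.sum_le_sum fun j _ => hS.eigenvalues₀_antitone (by
        rw [Fin.le_def]
        simp only [Fin.val_castLE]
        omega)
  have hc : (Finset.univ.filter fun i : Fin (Fintype.card (Fin n)) => i.val < k).card = k := by
    have := sum_filter_val_lt hcard fun _ => 1
    simpa using this
  have hc' : ((Finset.univ.filter fun i : Fin (Fintype.card (Fin n)) => ¬ i.val < k).card : ℝ)
      = n - k := by
    have := Finset.card_filter_add_card_filter_not (s := Finset.univ)
      (fun i : Fin (Fintype.card (Fin n)) => i.val < k)
    have hn : Fintype.card (Fin (Fintype.card (Fin n))) = n := by simp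
    rw [hc, Finset.card_univ, hn] at this
    rw [eq_sub_iff_add_eq']
    exact_mod_cast this
  rw [htr, ← Finset.sum_filter_add_sum_filter_not _ (fun i => i.val < k), mul_add, Finset.mul_sum]
  have h2 : (k : ℝ) * ∑ i with ¬ i.val < k, g i ≤ (n - k) * s := by
    rw [Finset.mul_sum, ← hc', ← nsmul_eq_mul, ← Finset.sum_const]
    exact Finset.sum_le_sum fun i hi => hle i (by simpa using hi)
  have h1 : ∑ i with i.val < k, (k : ℝ) * g i = k * s := by
    rw [← Finset.mul_sum]
    rfl
  rw [h1]
  linarith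

/-! ### The matrix inequality for the Jacobian -/

/-- The algebraic core. The claimed matrix is a sum of four positive semidefinite ones: the
conjugated hypothesis on A, the compound of the completed square, the gap between G^[k] and its
eigenvalue bound, and the slack in the gain condition. Keeping X, Y and G abstract serves both gain
conditions at once. -/
theorem posSemidef_compound_bound {n p k : ℕ} {A Q F S₁ S₂ G : Matrix (Fin n) (Fin n) ℝ}
    (hQ : Q.PosDef) {η₁ η₂ : ℝ}
    (hARI : (-(mulCompound k (Q * Q) * addCompound k A
        + (addCompound k A)ᵀ * mulCompound k (Q * Q) + η₁ • mulCompound k (Q * Q)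
        + mulCompound k Q * (addCompound k S₁ + addCompound k S₂) * mulCompound k Q)).PosSemidef)
    (X : Matrix (Fin n) (Fin p) ℝ) (Y : Matrix (Fin p) (Fin n) ℝ) (hXY : X * Y = Q * F * Q⁻¹)
    (hG : G.IsHermitian) (hsum : X * Xᵀ + Yᵀ * Y = S₁ + S₂ + G)
    (hgain : sumLargestEigenvalues k G hG ≤ -η₂) :
    (-(η₁ + η₂) • 1 - (mulCompound k Q * addCompound k (A - F) * mulCompound k Q⁻¹ +
      (mulCompound k Q * addCompound k (A - F) * mulCompound k Q⁻¹)ᵀ)).PosSemidef := by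
  have hQQ : Q * Q⁻¹ = 1 := Matrix.mul_nonsing_inv _ ((Matrix.isUnit_iff_isUnit_det _).mp hQ.isUnit)
  have hQt : Qᵀ = Q := by simpa [Matrix.IsHermitian] using hQ.isHermitian
  set H := mulCompound k Q with hH
  set H' := mulCompound k Q⁻¹ with hH'
  have hHH' : H * H' = 1 := mulCompound_mul_eq_one k hQQ
  have hH'H : H' * H = 1 := mul_eq_one_comm.mp hHH'
  have hHt : Hᵀ = H := by rw [hH, ← mulCompound_transpose, hQt]
  have hH't : H'ᵀ = H' := by
    rw [hH', ← mulCompound_transpose, Matrix.transpose_nonsing_inv, hQt]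
  have e0 : H * addCompound k (A - F) * H' = H * addCompound k A * H' - addCompound k (X * Y) := by
    rw [addCompound_sub, hXY, addCompound_conj k _ _ _ hQQ, mul_sub, sub_mul]
  have p1 := posSemidef_conj hARI H'
  have e1 : H' * (-(mulCompound k (Q * Q) * addCompound k A
        + (addCompound k A)ᵀ * mulCompound k (Q * Q) + η₁ • mulCompound k (Q * Q)
        + H * (addCompound k S₁ + addCompound k S₂) * H)) * H'ᵀ
      = -(H * addCompound k A * H' + H' * (addCompound k A)ᵀ * H + η₁ • 1
        + (addCompound k S₁ + addCompound k S₂)) := by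
    rw [mulCompound_mul, ← hH, hH't]
    have a1 : H' * (H * H * addCompound k A) * H' = H * addCompound k A * H' := by
      rw [Matrix.mul_assoc H H, ← Matrix.mul_assoc H' H, hH'H, Matrix.one_mul]
    have a2 : H' * ((addCompound k A)ᵀ * (H * H)) * H' = H' * (addCompound k A)ᵀ * H := by
      simp only [Matrix.mul_assoc, hHH', Matrix.mul_one]
    have a3 : H' * (H * H) * H' = 1 := by
      rw [← Matrix.mul_assoc, hH'H, Matrix.one_mul, hHH']
    have a4 : ∀ Z, H' * (H * Z * H) * H' = Z := fun Z => by
      rw [Matrix.mul_assoc H' _ H', Matrix.mul_assoc (H * Z) H H', hHH', Matrix.mul_one,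
        ← Matrix.mul_assoc, hH'H, Matrix.one_mul]
    generalize addCompound k S₁ + addCompound k S₂ = Z
    simp only [Matrix.mul_neg, Matrix.neg_mul, Matrix.mul_add, Matrix.add_mul, a1, a2,
      Matrix.mul_smul, Matrix.smul_mul, a3, a4]
  rw [e1] at p1
  have p2 : (addCompound k ((X + Yᵀ) * (X + Yᵀ)ᵀ)).PosSemidef := by
    refine posSemidef_addCompound k ?_
    have := posSemidef_self_mul_conjTranspose (X + Yᵀ)
    rwa [conjTranspose_eq_transpose_of_trivial] at this
  have p3 := posSemidef_smul_one_sub_addCompound k hG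
  have p4 : ((-η₂ - sumLargestEigenvalues k G hG) •
      (1 : Matrix (Fin k ↪o Fin n) (Fin k ↪o Fin n) ℝ)).PosSemidef :=
    PosSemidef.one.smul (by linarith)
  have e2 : (X + Yᵀ) * (X + Yᵀ)ᵀ = S₁ + S₂ + G + X * Y + (X * Y)ᵀ := by
    rw [← hsum, Matrix.transpose_add, Matrix.transpose_transpose, Matrix.add_mul, Matrix.mul_add,
      Matrix.mul_add, Matrix.transpose_mul]
    abel
  convert ((p1.add p2).add p3).add p4 using 1
  rw [e0, e2]
  generalize X * Y = Z
  simp only [addCompound_add, addCompound_transpose, Matrix.transpose_sub, Matrix.transpose_mul,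
    hHt, hH't, neg_smul, sub_smul, add_smul, Matrix.mul_assoc]
  abel

/-- The Jacobian `A - B J C` of a Lurie system satisfies the compound Lyapunov inequality. -/
theorem posSemidef_lurie_bound {n m q k : ℕ} {A Q : Matrix (Fin n) (Fin n) ℝ}
    {B : Matrix (Fin n) (Fin m) ℝ} {C : Matrix (Fin q) (Fin n) ℝ} (hQ : Q.PosDef) {η₁ η₂ : ℝ}
    (hARI : (-(mulCompound k (Q * Q) * addCompound k A
        + (addCompound k A)ᵀ * mulCompound k (Q * Q) + η₁ • mulCompound k (Q * Q)
        + mulCompound k Q * (addCompound k (Q * B * Bᵀ * Q)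
            + addCompound k (Q⁻¹ * Cᵀ * C * Q⁻¹)) * mulCompound k Q)).PosSemidef)
    (J : Matrix (Fin m) (Fin q) ℝ)
    (hgain : sumLargestEigenvalues k (Q⁻¹ * Cᵀ * (Jᵀ * J - 1) * C * Q⁻¹)
        (isHermitian_gainC hQ.isHermitian C J) ≤ -η₂ ∨
      sumLargestEigenvalues k (Q * B * (J * Jᵀ - 1) * Bᵀ * Q)
        (isHermitian_gainB hQ.isHermitian B J) ≤ -η₂) :
    (-(η₁ + η₂) • 1 - (mulCompound k Q * addCompound k (A - B * J * C) * mulCompound k Q⁻¹ +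
      (mulCompound k Q * addCompound k (A - B * J * C) * mulCompound k Q⁻¹)ᵀ)).PosSemidef := by
  have hQt : Qᵀ = Q := by simpa [Matrix.IsHermitian] using hQ.isHermitian
  have hQt' : (Q⁻¹)ᵀ = Q⁻¹ := by rw [Matrix.transpose_nonsing_inv, hQt]
  rcases hgain with h | h
  -- J goes into the right factor: XXᵀ = S₁ and YᵀY = S₂ + G.
  · refine posSemidef_compound_bound hQ hARI (Q * B) (J * C * Q⁻¹) ?_ _ ?_ h
    · simp only [Matrix.mul_assoc]
    · simp only [Matrix.transpose_mul, hQt, hQt', Matrix.mul_sub, Matrix.sub_mul, Matrix.mul_assoc,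
        Matrix.one_mul]
      abel
  -- J goes into the left factor: XXᵀ = S₁ + G and YᵀY = S₂.
  · refine posSemidef_compound_bound hQ hARI (Q * B * J) (C * Q⁻¹) ?_ _ ?_ h
    · simp only [Matrix.mul_assoc]
    · simp only [Matrix.transpose_mul, hQt, hQt', Matrix.mul_sub, Matrix.sub_mul, Matrix.mul_assoc,
        Matrix.one_mul]
      abel

/-! ### The matrix measure of a scaled Euclidean norm -/

theorem norm_toLp_sq {ι : Type*} [Fintype ι] (v : ι → ℝ) :
    ‖WithLp.toLp 2 v‖ ^ 2 = v ⬝ᵥ v := by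
  rw [EuclideanSpace.norm_sq_eq]
  simp [dotProduct, pow_two]

theorem dotProduct_mulVec_le {ι : Type*} [Fintype ι] [DecidableEq ι] {T : Matrix ι ι ℝ} {c : ℝ}
    (hT : (c • 1 - (T + Tᵀ)).PosSemidef) (z : ι → ℝ) :
    z ⬝ᵥ T *ᵥ z ≤ c / 2 * (z ⬝ᵥ z) := by
  have h := hT.dotProduct_mulVec_nonneg z
  have h2 : z ⬝ᵥ Tᵀ *ᵥ z = z ⬝ᵥ T *ᵥ z := by
    rw [Matrix.mulVec_transpose, dotProduct_comm, ← Matrix.dotProduct_mulVec]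
  simp only [star_trivial, Matrix.sub_mulVec, Matrix.add_mulVec, Matrix.smul_mulVec,
    Matrix.one_mulVec, dotProduct_sub, dotProduct_add, dotProduct_smul, smul_eq_mul, h2] at h
  linarith

/-- z ↦ H z carries the scaled unit sphere onto the Euclidean one. Nonemptiness of the index set
makes that sphere nonempty. -/
theorem inducedNorm_scaledNorm {ι : Type*} [Fintype ι] [DecidableEq ι] [Nonempty ι]
    {H H' : Matrix ι ι ℝ} (hH : H * H' = 1) (M : Matrix ι ι ℝ) :
    inducedNorm (scaledNorm H) M = ‖toEuclideanCLM (𝕜 := ℝ) (H * M * H')‖ := by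
  have hH' : H' * H = 1 := mul_eq_one_comm.mp hH
  rw [← ContinuousLinearMap.sSup_sphere_eq_norm, inducedNorm]
  congr 1
  ext r
  constructor
  · rintro ⟨x, hx, rfl⟩
    refine ⟨WithLp.toLp 2 (H *ᵥ x), by simpa [scaledNorm] using hx, ?_⟩
    simp only [scaledNorm, toEuclideanCLM_toLp, Matrix.mulVec_mulVec, Matrix.mul_assoc, hH',
      Matrix.mul_one]
  · rintro ⟨y, hy, rfl⟩
    have hy1 : y = WithLp.toLp 2 (H *ᵥ (H' *ᵥ (WithLp.ofLp y))) := by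
      simp [Matrix.mulVec_mulVec, hH]
    refine ⟨H' *ᵥ (WithLp.ofLp y), ?_, ?_⟩
    · simp only [Set.mem_ofPred_eq, scaledNorm]
      rw [← hy1]
      simpa using hy
    · simp only [scaledNorm]
      conv_rhs => rw [hy1]
      simp only [toEuclideanCLM_toLp, Matrix.mulVec_mulVec, Matrix.mul_assoc, hH,
        Matrix.mul_one]

/-- Expand |z + εTz|² and use 1 + 2s ≤ (1 + s)² with s = εc + ε²‖T‖²/2, which avoids square roots.
Since c may be negative, 1 + s ≥ 0 has to be assumed. -/
theorem norm_one_add_smul_le {ι : Type*} [Fintype ι] [DecidableEq ι] {T : Matrix ι ι ℝ} {c : ℝ}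
    (hT : ∀ z : ι → ℝ, z ⬝ᵥ T *ᵥ z ≤ c * (z ⬝ᵥ z)) {ε : ℝ} (hε : 0 ≤ ε)
    (hb : 0 ≤ 1 + ε * c + ε ^ 2 * ‖toEuclideanCLM (𝕜 := ℝ) T‖ ^ 2 / 2) :
    ‖1 + ε • toEuclideanCLM (𝕜 := ℝ) T‖
      ≤ 1 + ε * c + ε ^ 2 * ‖toEuclideanCLM (𝕜 := ℝ) T‖ ^ 2 / 2 := by
  set K := ‖toEuclideanCLM (𝕜 := ℝ) T‖ with hK
  refine ContinuousLinearMap.opNorm_le_bound _ hb fun y => ?_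
  obtain ⟨z, rfl⟩ : ∃ z, y = WithLp.toLp 2 z := ⟨WithLp.ofLp y, rfl⟩
  refine le_of_sq_le_sq ?_ (by positivity)
  have e : (1 + ε • toEuclideanCLM (𝕜 := ℝ) T) (WithLp.toLp 2 z)
      = WithLp.toLp 2 (z + ε • (T *ᵥ z)) := by
    simp [toEuclideanCLM_toLp]
  have hTz : (T *ᵥ z) ⬝ᵥ (T *ᵥ z) ≤ K ^ 2 * (z ⬝ᵥ z) := by
    rw [← norm_toLp_sq, ← norm_toLp_sq, ← mul_pow, ← toEuclideanCLM_toLp]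
    gcongr
    exact ContinuousLinearMap.le_opNorm _ _
  have hzz : 0 ≤ z ⬝ᵥ z := by
    rw [← norm_toLp_sq]
    positivity
  rw [e, mul_pow, norm_toLp_sq, norm_toLp_sq]
  simp only [dotProduct_add, add_dotProduct, dotProduct_smul, smul_dotProduct, smul_eq_mul,
    dotProduct_comm (T *ᵥ z) z]
  have h1 := mul_le_mul_of_nonneg_left (hT z) hε
  have h2 := mul_le_mul_of_nonneg_left hTz (sq_nonneg ε)
  have h3 : 0 ≤ (ε * c + ε ^ 2 * K ^ 2 / 2) ^ 2 * (z ⬝ᵥ z) := by positivity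
  nlinarith

/-- ε ↦ ‖1 + εT‖ is convex, so it has a right derivative at 0. -/
theorem exists_tendsto_norm_one_add_smul {R : Type*} [NormedRing R] [NormedAlgebra ℝ R]
    [NormOneClass R] (T : R) :
    ∃ μ, Tendsto (fun ε : ℝ => (‖1 + ε • T‖ - 1) / ε) (𝓝[>] 0) (𝓝 μ) := by
  set g : ℝ → ℝ := fun ε => ‖1 + ε • T‖ with hg
  have hconv : ConvexOn ℝ Set.univ g := by
    refine ⟨convex_univ, fun x _ y _ a b ha hb hab => ?_⟩
    have : (1 : R) + (a • x + b • y) • T = a • (1 + x • T) + b • (1 + y • T) := by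
      rw [smul_add, smul_add, add_add_add_comm, ← add_smul, hab, one_smul, add_smul,
        smul_assoc, smul_assoc]
    simp only [hg]
    rw [this]
    refine (norm_add_le _ _).trans ?_
    rw [norm_smul, norm_smul, Real.norm_of_nonneg ha, Real.norm_of_nonneg hb]
    rfl
  have hd := hconv.hasDerivWithinAt_rightDeriv_of_mem_interior (x := 0) (by simp)
  rw [hasDerivWithinAt_iff_tendsto_slope' (by simp)] at hd
  have hg0 : g 0 = 1 := by simp [hg]
  refine ⟨derivWithin g (Set.Ioi 0) 0, hd.congr fun ε => ?_⟩
  rw [slope_def_field, hg0, sub_zero]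

theorem exists_isMatrixMeasure_le {ι : Type*} [Fintype ι] [DecidableEq ι] [Nonempty ι]
    {H H' : Matrix ι ι ℝ} (hH : H * H' = 1) {M : Matrix ι ι ℝ} {c : ℝ}
    (hM : ∀ z : ι → ℝ, z ⬝ᵥ (H * M * H') *ᵥ z ≤ c * (z ⬝ᵥ z)) :
    ∃ μ, IsMatrixMeasure (scaledNorm H) M μ ∧ μ ≤ c := by
  have hind : ∀ ε : ℝ, inducedNorm (scaledNorm H) (1 + ε • M) =
      ‖1 + ε • toEuclideanCLM (𝕜 := ℝ) (H * M * H')‖ := fun ε => by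
    rw [inducedNorm_scaledNorm hH, Matrix.mul_add, Matrix.add_mul, Matrix.mul_one, hH,
      Matrix.mul_smul, Matrix.smul_mul, map_add, map_one, map_smul]
  obtain ⟨μ, hμ⟩ := exists_tendsto_norm_one_add_smul (toEuclideanCLM (𝕜 := ℝ) (H * M * H'))
  refine ⟨μ, ?_, ?_⟩
  · unfold IsMatrixMeasure
    simp only [hind]
    exact hμ
  · generalize hK : ‖toEuclideanCLM (𝕜 := ℝ) (H * M * H')‖ = K
    have hlim : Tendsto (fun ε : ℝ => c + ε * K ^ 2 / 2) (𝓝[>] 0) (𝓝 c) := by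
      have : Continuous fun ε : ℝ => c + ε * K ^ 2 / 2 := by fun_prop
      simpa using (this.tendsto 0).mono_left nhdsWithin_le_nhds
    refine le_of_tendsto_of_tendsto hμ hlim ?_
    have hpos : ∀ᶠ ε : ℝ in 𝓝[>] 0, 0 < 1 + ε * c + ε ^ 2 * K ^ 2 / 2 := by
      have : Continuous fun ε : ℝ => 1 + ε * c + ε ^ 2 * K ^ 2 / 2 := by fun_prop
      exact nhdsWithin_le_nhds
        ((this.tendsto 0).eventually (lt_mem_nhds (by norm_num)))
    filter_upwards [hpos, self_mem_nhdsWithin] with ε h1 (h2 : 0 < ε)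
    rw [div_le_iff₀ h2]
    have := norm_one_add_smul_le hM h2.le (by rw [hK]; exact h1.le)
    rw [hK] at this
    linarith

/-! ### Global flows of Lipschitz equations -/

section ODE

open Set
open scoped NNReal

variable {E : Type*} [NormedAddCommGroup E] [NormedSpace ℝ E]

/-- The step length depends on neither the starting time nor the starting point, so local solutions
can be chained forever. If M bounds the field at x over the time interval, then (1 + K)M bounds it
on the ball of radius M, and a step of (1 + K)⁻¹ cannot leave that ball. -/
theorem exists_integralCurveOn_Icc [CompleteSpace E] {f : ℝ → E → E} {K : ℝ≥0}
    (hlip : ∀ t, LipschitzWith K (f t)) (hcont : ∀ x, Continuous fun t => f t x) (s : ℝ) (x : E) :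
    ∃ γ : ℝ → E, γ s = x ∧ IsIntegralCurveOn γ f (Icc s (s + (1 + (K : ℝ))⁻¹)) := by
  set δ : ℝ := (1 + (K : ℝ))⁻¹ with hδ
  have hδ0 : 0 < δ := by positivity
  obtain ⟨M, hM⟩ := (isCompact_Icc (a := s) (b := s + δ)).exists_bound_of_continuousOn
    (hcont x).continuousOn
  have hM0 : 0 ≤ M := (norm_nonneg _).trans (hM s ⟨le_rfl, by linarith⟩)
  lift M to ℝ≥0 using hM0
  have hPL : IsPicardLindelof f (tmin := s) (tmax := s + δ) ⟨s, le_rfl, by linarith⟩ x M 0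
      (M + K * M) K := by
    refine ⟨fun t _ => (hlip t).lipschitzOnWith, fun y _ => (hcont y).continuousOn,
      fun t ht y hy => ?_, ?_⟩
    · have h1 := (hlip t).norm_sub_le y x
      have h2 : ‖f t y‖ ≤ ‖f t x‖ + ‖f t y - f t x‖ := by
        simpa using norm_add_le (f t x) (f t y - f t x)
      have h3 : ‖y - x‖ ≤ M := by simpa [dist_eq_norm] using hy
      have h4 := hM t ht
      push_cast
      have h5 : (K : ℝ) * ‖y - x‖ ≤ K * M := by gcongr
      linarith
    · simp only [add_sub_cancel_left, sub_self, NNReal.coe_zero, sub_zero]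
      rw [max_eq_left hδ0.le]
      push_cast
      have : (1 + (K : ℝ)) ≠ 0 := by positivity
      rw [hδ, ← one_add_mul, mul_right_comm, mul_inv_cancel₀ this, one_mul]
  exact hPL.exists_eq_forall_mem_Icc_hasDerivWithinAt₀

/-- A vector field that is globally Lipschitz in space has global forward solutions. -/
theorem exists_integralCurveOn_Ici [CompleteSpace E] {f : ℝ → E → E} {K : ℝ≥0}
    (hlip : ∀ t, LipschitzWith K (f t)) (hcont : ∀ x, Continuous fun t => f t x) (t₀ : ℝ)
    (x₀ : E) : ∃ γ : ℝ → E, γ t₀ = x₀ ∧ IsIntegralCurveOn γ f (Ici t₀) := by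
  set δ : ℝ := (1 + (K : ℝ))⁻¹ with hδ
  have hδ0 : 0 < δ := by positivity
  choose c hc0 hc using exists_integralCurveOn_Icc hlip hcont
  let s : ℕ → ℝ := fun j => t₀ + j * δ
  have hs : ∀ j, s (j + 1) = s j + δ := fun j => by simp only [s]; push_cast; ring
  -- `p j` is the state reached at grid time `s j`, from which the next local solution restarts.
  let p : ℕ → E := fun j => Nat.rec x₀ (fun i y => c (s i) y (s i + δ)) j
  have hp : ∀ j, p (j + 1) = c (s j) (p j) (s j + δ) := fun j => rfl
  let γ : ℝ → E := fun t => c (s ⌊(t - t₀) / δ⌋₊) (p ⌊(t - t₀) / δ⌋₊) t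
  have hfloor : ∀ j t, s j ≤ t → t < s (j + 1) → ⌊(t - t₀) / δ⌋₊ = j := fun j t h1 h2 => by
    simp only [s] at h1 h2
    rw [Nat.floor_eq_iff (div_nonneg (by nlinarith [(Nat.cast_nonneg j : (0 : ℝ) ≤ j)]) hδ0.le),
      le_div_iff₀ hδ0, div_lt_iff₀ hδ0]
    push_cast at h2
    constructor <;> linarith
  have hγ : ∀ j, EqOn γ (c (s j) (p j)) (Icc (s j) (s (j + 1))) := fun j t ht => by
    rcases ht.2.lt_or_eq with h | h
    · simp only [γ, hfloor j t ht.1 h]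
    · have h2 : ⌊(t - t₀) / δ⌋₊ = j + 1 :=
        hfloor (j + 1) t h.ge (by rw [h, hs (j + 1)]; linarith)
      simp only [γ, h2]
      rw [h, hc0, hp, hs]
  have hder : ∀ j, ∀ t ∈ Icc (s j) (s (j + 1)),
      HasDerivWithinAt γ (f t (γ t)) (Icc (s j) (s (j + 1))) t := fun j t ht => by
    rw [hγ j ht]
    refine HasDerivWithinAt.congr ?_ (hγ j) (hγ j ht)
    have := hc (s j) (p j)
    rw [← hδ, ← hs] at this
    exact this t ht
  have hs0 : s 0 = t₀ := by simp [s]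
  refine ⟨γ, ?_, fun t ht => ?_⟩
  · have := hγ 0 (x := t₀) ⟨hs0.le, by rw [hs, hs0]; linarith⟩
    rw [this, ← hs0, hc0]
    rfl
  · set j := ⌊(t - t₀) / δ⌋₊ with hj
    have hq : 0 ≤ (t - t₀) / δ := div_nonneg (sub_nonneg.mpr ht) hδ0.le
    have h1 : s j ≤ t := by
      have := Nat.floor_le hq
      rw [le_div_iff₀ hδ0] at this
      simp only [s]
      linarith
    have h2 : t < s (j + 1) := by
      have := Nat.lt_floor_add_one ((t - t₀) / δ)
      rw [div_lt_iff₀ hδ0] at this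
      simp only [s]
      push_cast
      linarith
    have hd := hder j t ⟨h1, h2.le⟩
    -- Inside a cell the derivative is two-sided; at t₀ only the right one is needed; at a later
    -- grid point the derivatives from the two adjacent cells agree and glue.
    rcases h1.lt_or_eq with h | h
    · exact (hd.hasDerivAt (Icc_mem_nhds h h2)).hasDerivWithinAt
    · rcases Nat.eq_zero_or_pos j with h0 | h0
      · refine hd.mono_of_mem_nhdsWithin ?_
        rw [h0] at h h2 ⊢
        rw [h, hs0.symm.trans h]
        exact Icc_mem_nhdsGE h2
      · obtain ⟨i, hi⟩ : ∃ i, j = i + 1 := ⟨j - 1, by omega⟩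
        rw [hi] at h h2 hd
        have hlt : s i < t := by rw [← h, hs]; linarith
        have hd' := hder i t ⟨hlt.le, h.ge⟩
        have hu := hd'.union hd
        refine (hu.hasDerivAt ?_).hasDerivWithinAt
        refine mem_of_superset (Icc_mem_nhds hlt h2) fun y hy => ?_
        rcases le_total y (s (i + 1)) with hy' | hy'
        · exact Or.inl ⟨hy.1, hy'⟩
        · exact Or.inr ⟨hy', hy.2⟩

theorem _root_.IsIntegralCurveOn.continuousOn_Icc {γ : ℝ → E} {f : ℝ → E → E} {t₀ : ℝ}
    (h : IsIntegralCurveOn γ f (Ici t₀)) (T : ℝ) : ContinuousOn γ (Icc t₀ T) :=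
  fun t ht => ((h t ht.1).mono Icc_subset_Ici_self).continuousWithinAt

theorem _root_.IsIntegralCurveOn.hasDerivWithinAt_Ici {γ : ℝ → E} {f : ℝ → E → E} {t₀ t : ℝ}
    (h : IsIntegralCurveOn γ f (Ici t₀)) (ht : t₀ ≤ t) :
    HasDerivWithinAt γ (f t (γ t)) (Ici t) t :=
  (h t ht).mono (Ici_subset_Ici.mpr ht)

theorem gronwallBound_zero_left (K e x : ℝ) :
    gronwallBound 0 K e x = e * gronwallBound 0 K 1 x := by
  unfold gronwallBound
  split_ifs <;> ring

/-- The flow of a vector field with continuous, bounded spatial derivative is differentiable in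
the initial value, and its derivative solves the variational equation. -/
theorem exists_variational_solution [CompleteSpace E] {f : ℝ → E → E} {f' : ℝ → E → E →L[ℝ] E}
    {K : ℝ≥0} (hlip : ∀ t, LipschitzWith K (f t)) (hf' : ∀ t x, HasFDerivAt (f t) (f' t x) x)
    (hf'c : Continuous fun p : ℝ × E => f' p.1 p.2) {t₀ : ℝ} {X : ℝ → E → E}
    (hX0 : ∀ a, X t₀ a = a) (hX : ∀ a, IsIntegralCurveOn (fun t => X t a) f (Ici t₀)) (a : E) :
    ∃ Y : ℝ → E →L[ℝ] E, Y t₀ = 1 ∧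
      IsIntegralCurveOn Y (fun t M => f' t (X t a) * M) (Ici t₀) ∧
      ∀ t, t₀ ≤ t → HasFDerivAt (X t) (Y t) a := by
  -- The trajectory is frozen before t₀, so that the variational equation has coefficients
  -- continuous on all of ℝ.
  have hXc : Continuous fun t => X (max t t₀) a := by
    have h : ContinuousOn (fun t => X t a) (Ici t₀) := fun t ht => (hX a t ht).continuousWithinAt
    exact h.comp_continuous (continuous_id.max continuous_const) fun t =>
      mem_Ici.mpr (le_max_right _ _)
  have hbd : ∀ t x, ‖f' t x‖ ≤ K := fun t x => (hf' t x).le_of_lipschitz (hlip t)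
  obtain ⟨Y, hY0, hY⟩ := exists_integralCurveOn_Ici
    (f := fun t (M : E →L[ℝ] E) => f' t (X (max t t₀) a) * M) (K := K)
    (fun t => LipschitzWith.of_dist_le_mul fun M N => by
      rw [dist_eq_norm, dist_eq_norm, ← mul_sub]
      exact (norm_mul_le _ _).trans (by gcongr; exact hbd _ _))
    (fun M => (hf'c.comp (continuous_id.prodMk hXc)).mul continuous_const) t₀ 1
  have hY' : IsIntegralCurveOn Y (fun t M => f' t (X t a) * M) (Ici t₀) := fun t ht => by
    have := hY t ht
    beta_reduce at this
    rwa [max_eq_left (show t₀ ≤ t from ht)] at this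
  refine ⟨Y, hY0, hY', fun T hT => ?_⟩
  obtain ⟨C, hC⟩ := isCompact_Icc.exists_bound_of_continuousOn (hY'.continuousOn_Icc T)
  have hC0 : 0 ≤ C := (norm_nonneg _).trans (hC t₀ ⟨le_rfl, hT⟩)
  set G := gronwallBound 0 K 1 (T - t₀) with hG
  have hG0 : 0 ≤ G := by
    have := gronwallBound_mono le_rfl zero_le_one K.2 (sub_nonneg.mpr hT)
    rwa [gronwallBound_x0] at this
  rw [hasFDerivAt_iff_isLittleO_nhds_zero, Asymptotics.isLittleO_iff]
  intro c hc
  -- Chosen so that ε C G ≤ c; the added 1 keeps the denominator positive.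
  set ε := c / (C * G + 1) with hε
  have hε0 : 0 < ε := by positivity
  have hunif : ∀ᶠ u : E in 𝓝 0, ∀ s ∈ Icc t₀ T,
      ‖f' s (X (max s t₀) a + u) - f' s (X (max s t₀) a)‖ < ε := by
    refine isCompact_Icc.eventually_forall_of_forall_eventually fun s _ => ?_
    have hcont : Continuous fun z : E × ℝ =>
        ‖f' z.2 (X (max z.2 t₀) a + z.1) - f' z.2 (X (max z.2 t₀) a)‖ := by
      have h1 : Continuous fun z : E × ℝ => X (max z.2 t₀) a := hXc.comp continuous_snd
      exact ((hf'c.comp (continuous_snd.prodMk (h1.add continuous_fst))).sub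
        (hf'c.comp (continuous_snd.prodMk h1))).norm
    exact (hcont.tendsto (0, s)).eventually (gt_mem_nhds (by simpa using hε0))
  obtain ⟨δ, hδ0, hδ⟩ := Metric.eventually_nhds_iff_ball.mp hunif
  have hsmall : ∀ᶠ h : E in 𝓝 0, C * ‖h‖ < δ := by
    have : Continuous fun h : E => C * ‖h‖ := by fun_prop
    exact (this.tendsto 0).eventually (gt_mem_nhds (by simpa using hδ0))
  filter_upwards [hsmall] with h hh
  have hYh : ∀ s ∈ Icc t₀ T, ‖Y s h‖ ≤ C * ‖h‖ := fun s hs =>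
    ((Y s).le_opNorm h).trans (by gcongr; exact hC s hs)
  have hdY : ∀ s, t₀ ≤ s → HasDerivWithinAt (fun s => X s a + Y s h)
      (f s (X s a) + f' s (X s a) (Y s h)) (Ici s) s := fun s hs =>
    ((hX a).hasDerivWithinAt_Ici hs).add
      (((ContinuousLinearMap.apply ℝ E h).hasFDerivAt.comp_hasDerivWithinAt s
        (hY'.hasDerivWithinAt_Ici hs)))
  have hcY : ContinuousOn (fun s => X s a + Y s h) (Icc t₀ T) :=
    ((hX a).continuousOn_Icc T).add ((hY'.continuousOn_Icc T).clm_apply continuousOn_const)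
  -- X s a + Y s h starts at a + h and solves the equation up to an error ε C ‖h‖, so Grönwall
  -- compares it with the true solution from a + h.
  have hgr := dist_le_of_approx_trajectories_ODE (δ := 0) (εf := ε * (C * ‖h‖)) (εg := 0) hlip hcY
    (fun s hs => hdY s hs.1) (fun s hs => ?_) ((hX (a + h)).continuousOn_Icc T)
    (fun s hs => (hX (a + h)).hasDerivWithinAt_Ici hs.1) (fun s hs => by rw [dist_self])
    (by simp [hX0, hY0]) T ⟨hT, le_rfl⟩
  · rw [add_zero, gronwallBound_zero_left, ← hG, dist_eq_norm, norm_sub_rev, ← sub_sub] at hgr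
    refine hgr.trans ?_
    have : ε * (C * G) ≤ c := by
      rw [hε, div_mul_eq_mul_div, div_le_iff₀ (by positivity)]
      nlinarith
    calc ε * (C * ‖h‖) * G = ε * (C * G) * ‖h‖ := by ring
      _ ≤ c * ‖h‖ := by gcongr
  · have hsI : s ∈ Icc t₀ T := ⟨hs.1, hs.2.le⟩
    -- The defect is the linearization error of f at X s a; the mean value inequality on the ball of
    -- uniform continuity bounds it by ε ‖Y s h‖.
    have hmv := (convex_ball (X s a) δ).norm_image_sub_le_of_norm_hasFDerivWithin_le'
      (f := f s) (f' := f' s) (φ := f' s (X s a)) (C := ε) (x := X s a) (y := X s a + Y s h)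
      (fun z _ => (hf' s z).hasFDerivWithinAt)
      (fun z hz => by
        have := hδ (z - X s a) (by simpa [dist_eq_norm] using hz) s hsI
        rw [max_eq_left hs.1] at this
        simpa using this.le)
      (Metric.mem_ball_self hδ0) (by simpa using (hYh s hsI).trans_lt hh)
    rw [add_sub_cancel_left] at hmv
    rw [dist_eq_norm, norm_sub_rev, ← sub_sub]
    exact hmv.trans (by gcongr; exact hYh s hsI)

end ODE

/-! ### Exponential decay for dissipative linear equations -/

theorem scaledNorm_le_exp_mul {ι : Type*} [Fintype ι] [DecidableEq ι] {H H' : Matrix ι ι ℝ}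
    (hH : H * H' = 1) {M : ℝ → Matrix ι ι ℝ} {z : ℝ → ι → ℝ} {t₀ η : ℝ}
    (hz : ∀ t, t₀ ≤ t → HasDerivWithinAt z (M t *ᵥ z t) (Set.Ici t₀) t)
    (hM : ∀ t, t₀ ≤ t → ∀ v : ι → ℝ, v ⬝ᵥ (H * M t * H') *ᵥ v ≤ -η * (v ⬝ᵥ v))
    {t : ℝ} (ht : t₀ ≤ t) :
    scaledNorm H (z t) ≤ Real.exp (-η * (t - t₀)) * scaledNorm H (z t₀) := by
  have hH' : H' * H = 1 := mul_eq_one_comm.mp hH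
  set u : ℝ → ι → ℝ := fun s => H *ᵥ z s with hu
  -- Weighted energy e^{2η(s - t₀)}|H z|²; dissipativity makes its derivative nonpositive.
  set g : ℝ → ℝ := fun s => Real.exp (2 * η * (s - t₀)) * (u s ⬝ᵥ u s) with hg
  have hud : ∀ s, t₀ ≤ s →
      HasDerivWithinAt u ((H * M s * H') *ᵥ u s) (Set.Ici t₀) s := fun s hs => by
    have h1 := (LinearMap.toContinuousLinearMap H.mulVecLin).hasFDerivAt.comp_hasDerivWithinAt s
      (hz s hs)
    have h2 : (H * M s * H') *ᵥ u s = H *ᵥ (M s *ᵥ z s) := by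
      simp only [hu, Matrix.mulVec_mulVec, Matrix.mul_assoc, hH', Matrix.mul_one]
    rw [h2]
    exact h1
  have hgd : ∀ s, t₀ ≤ s → HasDerivWithinAt g
      (Real.exp (2 * η * (s - t₀)) * (2 * η * (u s ⬝ᵥ u s)
        + 2 * (u s ⬝ᵥ (H * M s * H') *ᵥ u s))) (Set.Ici t₀) s := fun s hs => by
    have h1 : HasDerivWithinAt (fun s => u s ⬝ᵥ u s) (2 * (u s ⬝ᵥ (H * M s * H') *ᵥ u s))
        (Set.Ici t₀) s := by
      have h0 := hasDerivWithinAt_pi.mp (hud s hs)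
      have := HasDerivWithinAt.fun_sum (u := Finset.univ) fun i _ => (h0 i).mul (h0 i)
      refine this.congr_deriv ?_
      rw [dotProduct, Finset.mul_sum]
      exact Finset.sum_congr rfl fun i _ => by ring
    have h2 : HasDerivWithinAt (fun s => Real.exp (2 * η * (s - t₀)))
        (Real.exp (2 * η * (s - t₀)) * (2 * η)) (Set.Ici t₀) s := by
      have := (((hasDerivAt_id s).sub_const t₀).const_mul (2 * η)).exp
      simpa using this.hasDerivWithinAt
    refine (h2.mul h1).congr_deriv ?_
    ring
  have hanti : AntitoneOn g (Set.Ici t₀) := by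
    have hint : ∀ s ∈ interior (Set.Ici t₀), HasDerivAt g
        (Real.exp (2 * η * (s - t₀)) * (2 * η * (u s ⬝ᵥ u s)
          + 2 * (u s ⬝ᵥ (H * M s * H') *ᵥ u s))) s := fun s hs => by
      rw [interior_Ici] at hs
      exact (hgd s (le_of_lt hs)).hasDerivAt (Ici_mem_nhds hs)
    refine antitoneOn_of_deriv_nonpos (convex_Ici t₀)
      (fun s hs => (hgd s hs).continuousWithinAt)
      (fun s hs => (hint s hs).differentiableAt.differentiableWithinAt) fun s hs => ?_
    rw [(hint s hs).deriv]
    rw [interior_Ici] at hs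
    have := hM s (le_of_lt hs) (u s)
    exact mul_nonpos_of_nonneg_of_nonpos (Real.exp_pos _).le (by linarith)
  have hle := hanti (Set.mem_Ici.mpr le_rfl) (Set.mem_Ici.mpr ht) ht
  simp only [hg, sub_self, mul_zero, Real.exp_zero, one_mul] at hle
  refine le_of_sq_le_sq ?_ (mul_nonneg (Real.exp_pos _).le (norm_nonneg _))
  simp only [scaledNorm]
  rw [mul_pow, norm_toLp_sq, norm_toLp_sq, ← Real.exp_nat_mul]
  have he : Real.exp (((2 : ℕ) : ℝ) * (-η * (t - t₀))) * Real.exp (2 * η * (t - t₀)) = 1 := by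
    rw [← Real.exp_add]
    simp only [Nat.cast_ofNat]
    rw [show 2 * (-η * (t - t₀)) + 2 * η * (t - t₀) = 0 by ring, Real.exp_zero]
  calc u t ⬝ᵥ u t = Real.exp (((2 : ℕ) : ℝ) * (-η * (t - t₀))) *
        (Real.exp (2 * η * (t - t₀)) * (u t ⬝ᵥ u t)) := by rw [← mul_assoc, he, one_mul]
    _ ≤ _ := by gcongr

/-! ### Uniform bounds on the Jacobian -/

section Bounds

attribute [local instance] Matrix.linftyOpNormedAddCommGroup

/-- The trace of YᵀY is the sum of the squared entries of Y, so it bounds every entry. -/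
theorem exists_bound_mul_mul_of_trace_le {n p p' : ℕ} (L : Matrix (Fin n) (Fin p) ℝ)
    (R : Matrix (Fin p') (Fin n) ℝ) (r : ℝ) :
    ∃ K : ℝ, 0 ≤ K ∧ ∀ Y : Matrix (Fin p) (Fin p') ℝ, (Yᵀ * Y).trace ≤ r →
      ∀ v, ‖(L * Y * R) *ᵥ v‖ ≤ K * ‖v‖ := by
  refine ⟨‖L‖ * (p' * √r) * ‖R‖, by positivity, fun Y hY v => ?_⟩
  have hentry : ∀ i j, ‖Y i j‖ ≤ √r := fun i j => by
    refine Real.le_sqrt_of_sq_le (le_trans ?_ hY)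
    have h1 : (Yᵀ * Y).trace = ∑ j, ∑ i, Y i j ^ 2 := by
      simp [Matrix.trace, Matrix.mul_apply, pow_two]
    rw [h1, Real.norm_eq_abs, sq_abs]
    refine le_trans ?_ (Finset.single_le_sum (f := fun j => ∑ i, Y i j ^ 2)
      (fun j _ => Finset.sum_nonneg fun i _ => sq_nonneg _) (Finset.mem_univ j))
    exact Finset.single_le_sum (f := fun i => Y i j ^ 2) (fun i _ => sq_nonneg _)
      (Finset.mem_univ i)
  have hYn : ‖Y‖ ≤ p' * √r := by
    have h0 : ∀ i, ∑ j, ‖Y i j‖₊ ≤ Real.toNNReal (p' * √r) := fun i => by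
      rw [← NNReal.coe_le_coe, Real.coe_toNNReal _ (by positivity)]
      push_cast
      calc ∑ j, ‖Y i j‖ ≤ ∑ _j : Fin p', √r := Finset.sum_le_sum fun j _ => hentry i j
        _ = p' * √r := by simp
    rw [Matrix.linfty_opNorm_def, ← Real.coe_toNNReal (p' * √r) (by positivity)]
    exact_mod_cast Finset.sup_le fun i _ => h0 i
  calc ‖(L * Y * R) *ᵥ v‖ ≤ ‖L * Y * R‖ * ‖v‖ := Matrix.linfty_opNorm_mulVec _ _
    _ ≤ ‖L‖ * ‖Y‖ * ‖R‖ * ‖v‖ := by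
      gcongr
      refine (Matrix.linfty_opNorm_mul _ _).trans ?_
      gcongr
      exact Matrix.linfty_opNorm_mul _ _
    _ ≤ _ := by gcongr

/-- The trace is at most n/k times the sum of the k largest eigenvalues. Either gain condition
therefore bounds the Frobenius norm of J C Q⁻¹ or of Q B J, and B J C is recovered from either by
fixed factors. -/
theorem exists_bound_of_gain {n m q k : ℕ} (hk1 : 1 ≤ k) (hkn : k ≤ n)
    (A : Matrix (Fin n) (Fin n) ℝ) (B : Matrix (Fin n) (Fin m) ℝ) (C : Matrix (Fin q) (Fin n) ℝ)
    {Q : Matrix (Fin n) (Fin n) ℝ} (hQ : Q.PosDef) (η₂ : ℝ) :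
    ∃ K : ℝ, 0 ≤ K ∧ ∀ J : Matrix (Fin m) (Fin q) ℝ,
      (sumLargestEigenvalues k (Q⁻¹ * Cᵀ * (Jᵀ * J - 1) * C * Q⁻¹)
          (isHermitian_gainC hQ.isHermitian C J) ≤ -η₂ ∨
        sumLargestEigenvalues k (Q * B * (J * Jᵀ - 1) * Bᵀ * Q)
          (isHermitian_gainB hQ.isHermitian B J) ≤ -η₂) →
      ∀ v, ‖(A - B * J * C) *ᵥ v‖ ≤ K * ‖v‖ := by
  have hu := (Matrix.isUnit_iff_isUnit_det _).mp hQ.isUnit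
  have hQQ : Q * Q⁻¹ = 1 := Matrix.mul_nonsing_inv _ hu
  have hQQ' : Q⁻¹ * Q = 1 := Matrix.nonsing_inv_mul _ hu
  have hQt : Qᵀ = Q := by simpa [Matrix.IsHermitian] using hQ.isHermitian
  have hQt' : (Q⁻¹)ᵀ = Q⁻¹ := by rw [Matrix.transpose_nonsing_inv, hQt]
  have hk0 : (0 : ℝ) < k := by exact_mod_cast hk1
  have htr : ∀ {S : Matrix (Fin n) (Fin n) ℝ} (hS : S.IsHermitian),
      sumLargestEigenvalues k S hS ≤ -η₂ → S.trace ≤ n * -η₂ / k := fun {S} hS h => by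
    rw [le_div_iff₀ hk0, mul_comm]
    refine (mul_trace_le_mul_sumLargestEigenvalues hkn hS).trans ?_
    gcongr
  obtain ⟨K₁, hK₁, h₁⟩ := exists_bound_mul_mul_of_trace_le B Q
    ((Q⁻¹ * Cᵀ * C * Q⁻¹).trace + n * -η₂ / k)
  obtain ⟨K₂, hK₂, h₂⟩ := exists_bound_mul_mul_of_trace_le Q⁻¹ C
    ((Q * B * Bᵀ * Q).trace + n * -η₂ / k)
  refine ⟨‖A‖ + (K₁ + K₂), by positivity, fun J hJ v => ?_⟩
  have hBJC : ‖(B * J * C) *ᵥ v‖ ≤ (K₁ + K₂) * ‖v‖ := by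
    rcases hJ with h | h
    · have e : B * J * C = B * (J * C * Q⁻¹) * Q := by
        simp only [Matrix.mul_assoc, hQQ', Matrix.mul_one]
      rw [e]
      refine (h₁ _ ?_ v).trans (by gcongr; linarith)
      have e2 : (J * C * Q⁻¹)ᵀ * (J * C * Q⁻¹) = Q⁻¹ * Cᵀ * C * Q⁻¹
          + Q⁻¹ * Cᵀ * (Jᵀ * J - 1) * C * Q⁻¹ := by
        simp only [Matrix.transpose_mul, hQt', Matrix.mul_sub, Matrix.sub_mul, Matrix.mul_assoc,
          Matrix.one_mul]
        abel
      rw [e2, Matrix.trace_add]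
      gcongr
      exact htr _ h
    · have e : B * J * C = Q⁻¹ * (Q * B * J) * C := by
        simp only [← Matrix.mul_assoc, hQQ', Matrix.one_mul]
      rw [e]
      refine (h₂ _ ?_ v).trans (by gcongr; linarith)
      have e2 : (Q * B * J) * (Q * B * J)ᵀ = Q * B * Bᵀ * Q
          + Q * B * (J * Jᵀ - 1) * Bᵀ * Q := by
        simp only [Matrix.transpose_mul, hQt, Matrix.mul_sub, Matrix.sub_mul, Matrix.mul_assoc,
          Matrix.one_mul]
        abel
      rw [Matrix.trace_mul_comm, e2, Matrix.trace_add]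
      gcongr
      exact htr _ h
  rw [Matrix.sub_mulVec, add_mul]
  exact (norm_sub_le _ _).trans (add_le_add (Matrix.linfty_opNorm_mulVec _ _) hBJC)

end Bounds

/-! ### Smoothness of the vector field -/

/-- The slice at time t lies entirely in the half-space, so the within-derivative restricts to a
full derivative in y, even at t = 0. -/
theorem hasFDerivAt_slice {E F : Type*} [NormedAddCommGroup E] [NormedSpace ℝ E]
    [NormedAddCommGroup F] [NormedSpace ℝ F] {Φ : ℝ → E → F}
    (hΦ : ContDiffOn ℝ 1 (fun p : ℝ × E => Φ p.1 p.2) (Set.Ici 0 ×ˢ Set.univ))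
    {t : ℝ} (ht : 0 ≤ t) (y : E) :
    HasFDerivAt (Φ t) ((fderivWithin ℝ (fun p : ℝ × E => Φ p.1 p.2) (Set.Ici 0 ×ˢ Set.univ)
      (t, y)).comp (ContinuousLinearMap.inr ℝ ℝ E)) y := by
  have h1 := ((hΦ.differentiableOn one_ne_zero) (t, y)
    ⟨Set.mem_Ici.mpr ht, Set.mem_univ y⟩).hasFDerivWithinAt
  have h2 : HasFDerivWithinAt (fun y : E => (t, y)) (ContinuousLinearMap.inr ℝ ℝ E) Set.univ y :=
    (hasFDerivAt_prodMk_right t y).hasFDerivWithinAt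
  have h3 := h1.comp y h2 (fun z _ => ⟨Set.mem_Ici.mpr ht, Set.mem_univ z⟩)
  exact hasFDerivWithinAt_univ.mp h3

/-- Clamping time at 0 extends the data continuously to all of ℝ, as the existence results require.
-/
theorem continuous_fderiv_slice {E F : Type*} [NormedAddCommGroup E] [NormedSpace ℝ E]
    [NormedAddCommGroup F] [NormedSpace ℝ F] {Φ : ℝ → E → F}
    (hΦ : ContDiffOn ℝ 1 (fun p : ℝ × E => Φ p.1 p.2) (Set.Ici 0 ×ˢ Set.univ)) :
    Continuous fun p : ℝ × E => fderiv ℝ (Φ (max p.1 0)) p.2 := by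
  have h1 : ContinuousOn (fderivWithin ℝ (fun p : ℝ × E => Φ p.1 p.2) (Set.Ici 0 ×ˢ Set.univ))
      (Set.Ici 0 ×ˢ Set.univ) :=
    hΦ.continuousOn_fderivWithin ((uniqueDiffOn_Ici 0).prod uniqueDiffOn_univ) le_rfl
  have h2 : Continuous fun p : ℝ × E => fderivWithin ℝ (fun p : ℝ × E => Φ p.1 p.2)
      (Set.Ici 0 ×ˢ Set.univ) (max p.1 0, p.2) :=
    h1.comp_continuous (by fun_prop) fun p =>
      ⟨Set.mem_Ici.mpr (le_max_right _ _), Set.mem_univ _⟩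
  have h3 : (fun p : ℝ × E => fderiv ℝ (Φ (max p.1 0)) p.2) = fun p =>
      (fderivWithin ℝ (fun p : ℝ × E => Φ p.1 p.2) (Set.Ici 0 ×ˢ Set.univ)
        (max p.1 0, p.2)).comp (ContinuousLinearMap.inr ℝ ℝ E) :=
    funext fun p => (hasFDerivAt_slice hΦ (le_max_right _ _) _).fderiv
  rw [h3]
  exact h2.clm_comp continuous_const

/-- Multiplication by a matrix as a continuous linear map. -/
def mulVecCLM {n m : ℕ} (M : Matrix (Fin n) (Fin m) ℝ) : (Fin m → ℝ) →L[ℝ] (Fin n → ℝ) :=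
  LinearMap.toContinuousLinearMap M.mulVecLin

theorem jacobian_mulVec {n m : ℕ} (g : (Fin m → ℝ) → Fin n → ℝ) (y v : Fin m → ℝ) :
    jacobian g y *ᵥ v = fderiv ℝ g y v := by
  unfold jacobian
  rw [LinearMap.toMatrix'_mulVec]
  rfl

section VectorField

variable {n m q : ℕ} (A : Matrix (Fin n) (Fin n) ℝ) (B : Matrix (Fin n) (Fin m) ℝ)
  (C : Matrix (Fin q) (Fin n) ℝ) {Φ : ℝ → (Fin q → ℝ) → (Fin m → ℝ)}

theorem hasFDerivAt_vectorField
    (hΦ : ContDiffOn ℝ 1 (fun p : ℝ × (Fin q → ℝ) => Φ p.1 p.2) (Set.Ici 0 ×ˢ Set.univ))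
    {t : ℝ} (ht : 0 ≤ t) (x : Fin n → ℝ) :
    HasFDerivAt (vectorField A B C Φ t)
      (mulVecCLM A - (mulVecCLM B).comp ((fderiv ℝ (Φ t) (C *ᵥ x)).comp (mulVecCLM C))) x := by
  have h1 : HasFDerivAt (Φ t) (fderiv ℝ (Φ t) (C *ᵥ x)) (mulVecCLM C x) :=
    (hasFDerivAt_slice hΦ ht (C *ᵥ x)).differentiableAt.hasFDerivAt
  have h2 := h1.comp x (mulVecCLM C).hasFDerivAt
  exact (mulVecCLM A).hasFDerivAt.sub ((mulVecCLM B).hasFDerivAt.comp x h2)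

theorem jacobian_vectorField
    (hΦ : ContDiffOn ℝ 1 (fun p : ℝ × (Fin q → ℝ) => Φ p.1 p.2) (Set.Ici 0 ×ˢ Set.univ))
    {t : ℝ} (ht : 0 ≤ t) (x : Fin n → ℝ) :
    jacobian (vectorField A B C Φ t) x = A - B * jacobian (Φ t) (C *ᵥ x) * C := by
  refine Matrix.toLin'.injective (LinearMap.ext fun v => ?_)
  rw [Matrix.toLin'_apply, Matrix.toLin'_apply, jacobian_mulVec,
    (hasFDerivAt_vectorField A B C hΦ ht x).fderiv, Matrix.sub_mulVec, ← Matrix.mulVec_mulVec,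
    ← Matrix.mulVec_mulVec, jacobian_mulVec]
  rfl

theorem continuous_vectorField
    (hΦ : ContDiffOn ℝ 1 (fun p : ℝ × (Fin q → ℝ) => Φ p.1 p.2) (Set.Ici 0 ×ˢ Set.univ))
    (x : Fin n → ℝ) : Continuous fun t => vectorField A B C Φ (max t 0) x := by
  have h : Continuous fun t : ℝ => Φ (max t 0) (C *ᵥ x) :=
    hΦ.continuousOn.comp_continuous (f := fun t : ℝ => (max t 0, C *ᵥ x)) (by fun_prop) fun t =>
      ⟨Set.mem_Ici.mpr (le_max_right _ _), Set.mem_univ _⟩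
  exact continuous_const.sub ((mulVecCLM B).continuous.comp h)

theorem continuous_fderiv_vectorField
    (hΦ : ContDiffOn ℝ 1 (fun p : ℝ × (Fin q → ℝ) => Φ p.1 p.2) (Set.Ici 0 ×ˢ Set.univ)) :
    Continuous fun p : ℝ × (Fin n → ℝ) => fderiv ℝ (vectorField A B C Φ (max p.1 0)) p.2 := by
  have h : (fun p : ℝ × (Fin n → ℝ) => fderiv ℝ (vectorField A B C Φ (max p.1 0)) p.2) =
      fun p => mulVecCLM A - (mulVecCLM B).comp
        ((fderiv ℝ (Φ (max p.1 0)) (C *ᵥ p.2)).comp (mulVecCLM C)) :=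
    funext fun p => (hasFDerivAt_vectorField A B C hΦ (le_max_right _ _) p.2).fderiv
  rw [h]
  have h1 : Continuous fun p : ℝ × (Fin n → ℝ) => fderiv ℝ (Φ (max p.1 0)) (C *ᵥ p.2) :=
    (continuous_fderiv_slice hΦ).comp
      (continuous_fst.prodMk ((mulVecCLM C).continuous.comp continuous_snd))
  exact continuous_const.sub (continuous_const.clm_comp (h1.clm_comp continuous_const))

end VectorField

/-! ### From dissipative additive compounds to k-contraction -/

theorem isIntegralCurveOn_max_iff {E : Type*} [NormedAddCommGroup E] [NormedSpace ℝ E]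
    {γ : ℝ → E} {f : ℝ → E → E} {t₀ : ℝ} (ht₀ : 0 ≤ t₀) :
    IsIntegralCurveOn γ (fun t => f (max t 0)) (Set.Ici t₀) ↔
      IsIntegralCurveOn γ f (Set.Ici t₀) := by
  refine forall₂_congr fun t ht => ?_
  beta_reduce
  rw [max_eq_left (ht₀.trans ht)]

theorem differentiable_simplexMap {n k : ℕ} (a : Fin (k + 1) → Fin n → ℝ) :
    Differentiable ℝ (simplexMap a) := by
  unfold simplexMap
  fun_prop

/-- The wedge product of the columns of a solution of the variational equation solves the
compound equation. -/
theorem hasDerivWithinAt_wedge {n k : ℕ} {W : ℝ → Matrix (Fin n) (Fin k) ℝ}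
    {J : Matrix (Fin n) (Fin n) ℝ} {s : Set ℝ} {t : ℝ}
    (h : ∀ i j, HasDerivWithinAt (fun u => W u i j) ((J * W t) i j) s t) :
    HasDerivWithinAt (fun u => wedge (W u)) (addCompound k J *ᵥ wedge (W t)) s t := by
  refine hasDerivWithinAt_pi.mpr fun α => ?_
  have := hasDerivWithinAt_mulCompound k h α (RelEmbedding.refl (· ≤ ·))
  rw [mulCompoundDeriv_mul] at this
  exact this

/-- A system whose right-hand side has a continuous, bounded Jacobian, with additive compounds
that are dissipative for the scaled Euclidean norm, is `k`-contractive. -/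
theorem isKContractive_of_dissipative {n k : ℕ} {f : ℝ → (Fin n → ℝ) → (Fin n → ℝ)}
    {K : NNReal} (hdiff : ∀ t, 0 ≤ t → Differentiable ℝ (f t))
    (hbound : ∀ t, 0 ≤ t → ∀ x, ‖fderiv ℝ (f t) x‖ ≤ K)
    (hcont : ∀ x, Continuous fun t => f (max t 0) x)
    (hcont' : Continuous fun p : ℝ × (Fin n → ℝ) => fderiv ℝ (f (max p.1 0)) p.2)
    {H H' : Matrix (Fin k ↪o Fin n) (Fin k ↪o Fin n) ℝ} (hH : H * H' = 1) {η : ℝ} (hη : 0 < η)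
    (hdiss : ∀ t, 0 ≤ t → ∀ x (v : (Fin k ↪o Fin n) → ℝ),
      v ⬝ᵥ (H * addCompound k (jacobian (f t) x) * H') *ᵥ v ≤ -η * (v ⬝ᵥ v)) :
    IsKContractive f k (scaledNorm H) η := by
  have hlip : ∀ t, LipschitzWith K (f (max t 0)) := fun t =>
    lipschitzWith_of_nnnorm_fderiv_le (hdiff _ (le_max_right _ _))
      fun x => hbound _ (le_max_right _ _) x
  have hfd : ∀ t x, HasFDerivAt (f (max t 0)) (fderiv ℝ (f (max t 0)) x) x := fun t x =>
    (hdiff _ (le_max_right _ _) x).hasFDerivAt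
  have hvar : ∀ t₀ : ℝ, 0 ≤ t₀ → ∀ X, IsFlowFrom f t₀ X → ∀ a,
      ∃ Y : ℝ → (Fin n → ℝ) →L[ℝ] (Fin n → ℝ), Y t₀ = 1 ∧
        IsIntegralCurveOn Y (fun t M => fderiv ℝ (f (max t 0)) (X t a) * M) (Set.Ici t₀) ∧
        ∀ t, t₀ ≤ t → HasFDerivAt (X t) (Y t) a := fun t₀ ht₀ X hX a =>
    exists_variational_solution hlip hfd hcont' (fun a => (hX a).1)
      (fun a => (isIntegralCurveOn_max_iff ht₀).mpr (hX a).2) a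
  refine ⟨hη, fun t₀ ht₀ => ?_, fun t₀ ht₀ X hX t ht a => ?_,
    fun t₀ ht₀ X hX a r _ _ t ht => ?_⟩
  · choose γ hγ₀ hγ using exists_integralCurveOn_Ici hlip hcont t₀
    exact ⟨fun t a => γ a t, fun a => ⟨hγ₀ a, (isIntegralCurveOn_max_iff ht₀).mp (hγ a)⟩⟩
  · obtain ⟨Y, -, -, hY⟩ := hvar t₀ ht₀ X hX a
    exact (hY t ht).differentiableAt
  · obtain ⟨Y, -, hY, hYd⟩ := hvar t₀ ht₀ X hX (simplexMap a r)
    set S := jacobian (simplexMap a) r with hS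
    set W : ℝ → Matrix (Fin n) (Fin k) ℝ :=
      fun s => jacobian (fun u => X s (simplexMap a u)) r with hW
    -- Chain rule: the columns of W are the variational solution applied to the time-independent
    -- columns of S.
    have hWcol : ∀ s, t₀ ≤ s → ∀ i j, W s i j = Y s (fun b => S b j) i := fun s hs i j => by
      have h1 := (hYd s hs).comp r (differentiable_simplexMap a r).hasFDerivAt
      have h2 : (fun u => X s (simplexMap a u)) = X s ∘ simplexMap a := rfl
      have h3 : ∀ {p : ℕ} (M : Matrix (Fin p) (Fin k) ℝ),
          (fun b => M b j) = M *ᵥ Pi.single j 1 := fun M => by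
        simp only [Matrix.mulVec_single_one]
        rfl
      have h4 : W s i j = (fun b => W s b j) i := rfl
      rw [h4, h3, h3, hW, hS, jacobian_mulVec, jacobian_mulVec, h2, h1.fderiv]
      rfl
    have hWd : ∀ s, t₀ ≤ s → ∀ i j, HasDerivWithinAt (fun u => W u i j)
        ((jacobian (f s) (X s (simplexMap a r)) * W s) i j) (Set.Ici t₀) s := fun s hs i j => by
      have h1 := (ContinuousLinearMap.apply ℝ (Fin n → ℝ)
        (fun b => S b j)).hasFDerivAt.comp_hasDerivWithinAt s (hY s hs)
      have h2 := hasDerivWithinAt_pi.mp h1 i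
      have h3 : (jacobian (f s) (X s (simplexMap a r)) * W s) i j
          = (jacobian (f s) (X s (simplexMap a r)) *ᵥ (Y s fun b => S b j)) i := by
        rw [Matrix.mul_apply, Matrix.mulVec, dotProduct]
        exact Finset.sum_congr rfl fun b _ => by rw [hWcol s hs]
      rw [h3, jacobian_mulVec]
      beta_reduce at h2
      rw [max_eq_left (ht₀.trans hs)] at h2
      exact h2.congr (fun u hu => hWcol u hu i j) (hWcol s hs i j)
    exact scaledNorm_le_exp_mul hH (fun s hs => hasDerivWithinAt_wedge (hWd s hs))
      (fun s hs => hdiss s (ht₀.trans hs) _) ht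

end Lurie

end

theorem theorem1 {n m q : ℕ} (A : Matrix (Fin n) (Fin n) ℝ) (B : Matrix (Fin n) (Fin m) ℝ)
    (C : Matrix (Fin q) (Fin n) ℝ) (Φ : ℝ → (Fin q → ℝ) → (Fin m → ℝ))
    (hΦ : ContDiffOn ℝ 1 (fun p : ℝ × (Fin q → ℝ) => Φ p.1 p.2) (Set.Ici 0 ×ˢ Set.univ))
    (k : ℕ) (hk1 : 1 ≤ k) (hkn : k ≤ n) (η₁ η₂ : ℝ)
    (P Q : Matrix (Fin n) (Fin n) ℝ) (hQ : Q.PosDef) (hP : P = Q * Q)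
    (hARI : (-(Lurie.mulCompound k P * Lurie.addCompound k A
        + (Lurie.addCompound k A)ᵀ * Lurie.mulCompound k P + η₁ • Lurie.mulCompound k P
        + Lurie.mulCompound k Q * (Lurie.addCompound k (Q * B * Bᵀ * Q)
            + Lurie.addCompound k (Q⁻¹ * Cᵀ * C * Q⁻¹)) * Lurie.mulCompound k Q)).PosSemidef)
    (hgain : ∀ t : ℝ, 0 ≤ t → ∀ y : Fin q → ℝ,
      Lurie.sumLargestEigenvalues k
        (Q⁻¹ * Cᵀ * ((Lurie.jacobian (Φ t) y)ᵀ * Lurie.jacobian (Φ t) y - 1) * C * Q⁻¹)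
        (Lurie.isHermitian_gainC hQ.isHermitian C (Lurie.jacobian (Φ t) y)) ≤ -η₂ ∨
      Lurie.sumLargestEigenvalues k
        (Q * B * (Lurie.jacobian (Φ t) y * (Lurie.jacobian (Φ t) y)ᵀ - 1) * Bᵀ * Q)
        (Lurie.isHermitian_gainB hQ.isHermitian B (Lurie.jacobian (Φ t) y)) ≤ -η₂) :
    (∀ t : ℝ, 0 ≤ t → ∀ x : Fin n → ℝ, ∃ μ : ℝ,
      Lurie.IsMatrixMeasure (Lurie.scaledNorm (Lurie.mulCompound k Q))
        (Lurie.addCompound k (Lurie.jacobian (Lurie.vectorField A B C Φ t) x)) μ ∧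
      μ ≤ -(η₁ + η₂) / 2) ∧
    (0 < η₁ + η₂ →
      Lurie.IsKContractive (Lurie.vectorField A B C Φ) k
        (Lurie.scaledNorm (Lurie.mulCompound k Q)) ((η₁ + η₂) / 2)) := by
  have hQQ : Q * Q⁻¹ = 1 :=
    Matrix.mul_nonsing_inv _ ((Matrix.isUnit_iff_isUnit_det _).mp hQ.isUnit)
  have hH : Lurie.mulCompound k Q * Lurie.mulCompound k Q⁻¹ = 1 :=
    Lurie.mulCompound_mul_eq_one k hQQ
  rw [hP] at hARI
  have hdiss : ∀ t : ℝ, 0 ≤ t → ∀ (x : Fin n → ℝ) (v : (Fin k ↪o Fin n) → ℝ),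
      v ⬝ᵥ (Lurie.mulCompound k Q *
        Lurie.addCompound k (Lurie.jacobian (Lurie.vectorField A B C Φ t) x) *
        Lurie.mulCompound k Q⁻¹) *ᵥ v ≤ -(η₁ + η₂) / 2 * (v ⬝ᵥ v) := fun t ht x v => by
    rw [Lurie.jacobian_vectorField A B C hΦ ht x]
    exact Lurie.dotProduct_mulVec_le
      (Lurie.posSemidef_lurie_bound hQ hARI _ (hgain t ht (C *ᵥ x))) v
  -- k ≤ n gives an increasing k-sequence, so the compound space is nonzero, as the norm of the
  -- identity being 1 requires.
  have : Nonempty (Fin k ↪o Fin n) := ⟨Fin.castLEOrderEmb hkn⟩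
  refine ⟨fun t ht x => Lurie.exists_isMatrixMeasure_le hH (hdiss t ht x), fun hη => ?_⟩
  obtain ⟨K, hK0, hK⟩ := Lurie.exists_bound_of_gain hk1 hkn A B C hQ η₂
  lift K to NNReal using hK0
  refine Lurie.isKContractive_of_dissipative (K := K)
    (fun t ht x => (Lurie.hasFDerivAt_vectorField A B C hΦ ht x).differentiableAt)
    (fun t ht x => ContinuousLinearMap.opNorm_le_bound _ K.2 fun v => ?_)
    (Lurie.continuous_vectorField A B C hΦ) (Lurie.continuous_fderiv_vectorField A B C hΦ) hH
    (half_pos hη) fun t ht x v => ?_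
  · rw [← Lurie.jacobian_mulVec, Lurie.jacobian_vectorField A B C hΦ ht x]
    exact hK _ (hgain t ht (C *ᵥ x)) v
  · rw [← neg_div]
    exact hdiss t ht x v
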